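/- **Setting.** A distributed saddle point problem on $\mathbb R^n\times\mathbb R^n$ over $M$ nodes is $\min_x\max_y f(x,y)$, $f=\frac1M\sum_{m=1}^M f_m$, with $f_m$ differentiable, convex in $x$ and concave in $y$. Let $F_m(z)=(\nabla_xf_m(z),-\nabla_yf_m(z))$ for $z=(x,y)$, and $F=\frac1M\sum_m F_m$. The problem is called $(L,\mu)$-regular if $F$ is $L$-Lipschitz, every $F_m$ is $L_{\max}$-Lipschitz for some finite $L_{\max}$, and $\langle F(z_1)-F(z_2),z_1-z_2\rangle\ge\mu\|z_1-z_2\|^2$ for all $z_1,z_2$. A slowly time-varying network with condition number $\chi$ consists of graphs $\mathcal G^k=(\{1,\dots,M\},\mathcal E^k)$, $k\ge0$, and matrices $W^k\in\mathbb R^{M\times M}$ such that $|\mathcal E^k\,\triangle\,\mathcal E^{k+1}|\le2$; $W^k$ is positive semidefinite, $W^k_{ij}=0$ whenever $i\ne j$ and $(i,j)\notin\mathcal E^k$, $\ker W^k=\mathrm{span}(\mathbf 1)$; and $\sup_k\lambda_{\max}(W^k)/\lambda^+_{\min}(W^k)=\chi$, where $\lambda^+_{\min}$ is the smallest positive eigenvalue.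 A black-box procedure with $T$ local iterations and $K$ communication rounds keeps at each node $m$ memories $\mathcal M^x_m,\mathcal M^y_m\subseteq\mathbb R^n$, initially $\{0\}$, and performs, in any order, $T$ local iterations and $K$ communication rounds. In a local iteration every node performs one local computation: it adds to its memories finitely many points $x\in\mathrm{span}\{x',\nabla_xf_m(x'',y'')\}$ and $y\in\mathrm{span}\{y',\nabla_yf_m(x'',y'')\}$ with $x',x''\in\mathcal M^x_m$ and $y',y''\in\mathcal M^y_m$. In communication round $k=0,1,\dots,K-1$ the new memory $\mathcal M^x_m$ is contained in the span of the memories $\mathcal M^x_i$ of $i=m$ and of the neighbours $i$ of $m$ in $\mathcal G^k$; likewise for $\mathcal M^y_m$. The output is any $\hat x\in\mathrm{span}\bigcup_m\mathcal M^x_m$, $\hat y\in\mathrm{span}\bigcup_m\mathcal M^y_m$. It is an $\varepsilon$-solution if $\|\hat x-x^*\|^2+\|\hat y-y^*\|^2\le\varepsilon$, where $(x^*,y^*)$ is the saddle point of $f$. **Corollary.** For every $\kappa_0>1$ there are constants $c,\delta>0$, depending only on $\kappa_0$, such that for all $\mu>0$, $L\ge\kappa_0\mu$ and $\chi\ge1$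 there is a slowly time-varying network with condition number $\chi$ with the following property. For all $R,\varepsilon_0>0$ and all sufficiently large $n$ there is an $(L,\mu)$-regular distributed saddle point problem on $\mathbb R^n\times\mathbb R^n$ over the nodes of this network, with a saddle point $(x^*,y^*)$ such that $x^*\ne0$, $y^*\neq 0$, $\|y^*\|=R$ and $\|x^*\|\le2\|y^*\|$, such that for every $\varepsilon$ with $\varepsilon_0\le\varepsilon\le\delta\|y^*\|^2$, every black-box procedure with $T$ local iterations and $K$ communication rounds whose output is an $\varepsilon$-solution satisfies $$K\ \ge\ c\,\chi\,\frac L\mu\,\log\frac{\|y^*\|^2}{\varepsilon}\qquad\text{and}\qquad T\ \ge\ c\,\frac L\mu\,\log\frac{\|y^*\|^2}{\varepsilon}.$$ That is, $\Omega\big(\chi\frac L\mu\log\frac{\|y^*\|^2}{\varepsilon}\big)$ communication rounds and $\Omega\big(\frac L\mu\log\frac{\|y^*\|^2}{\varepsilon}\big)$ local computations per node are necessary. -/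

import Mathlib

noncomputable section

/-- The space `ℝⁿ` with its Euclidean norm. -/
abbrev EucSpace (n : ℕ) : Type := EuclideanSpace ℝ (Fin n)

/-! ### Distributed saddle point problems -/

/-- `∇_x g (x, y)`. -/
def gradX {n : ℕ} (g : EucSpace n → EucSpace n → ℝ) (x y : EucSpace n) : EucSpace n :=
  gradient (fun x' => g x' y) x

/-- `∇_y g (x, y)`. -/
def gradY {n : ℕ} (g : EucSpace n → EucSpace n → ℝ) (x y : EucSpace n) : EucSpace n :=
  gradient (fun y' => g x y') y

/-- The operator `z = (x, y) ↦ (∇_x g (x, y), -∇_y g (x, y))` on `ℝⁿ × ℝⁿ` with its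
Euclidean norm. -/
def saddleOp {n : ℕ} (g : EucSpace n → EucSpace n → ℝ)
    (z : WithLp 2 (EucSpace n × EucSpace n)) : WithLp 2 (EucSpace n × EucSpace n) :=
  WithLp.toLp 2 (gradX g z.fst z.snd, -gradY g z.fst z.snd)

/-- The global objective `f = (1 / M) ∑ f_m`. -/
def globalObjective {M n : ℕ} (f : Fin M → EucSpace n → EucSpace n → ℝ)
    (x y : EucSpace n) : ℝ :=
  (1 / (M : ℝ)) * ∑ m, f m x y

/-- The global operator `F = (1 / M) ∑ F_m`. -/
def globalOp {M n : ℕ} (f : Fin M → EucSpace n → EucSpace n → ℝ)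
    (z : WithLp 2 (EucSpace n × EucSpace n)) : WithLp 2 (EucSpace n × EucSpace n) :=
  (1 / (M : ℝ)) • ∑ m, saddleOp (f m) z

/-- The standing assumptions on the distributed problem
`min_x max_y (1 / M) ∑ f_m (x, y)` over `ℝⁿ × ℝⁿ`. -/
structure IsSaddleProblem {M n : ℕ} (f : Fin M → EucSpace n → EucSpace n → ℝ)
    (L μ : ℝ) : Prop where
  differentiable : ∀ m, Differentiable ℝ (fun z : EucSpace n × EucSpace n => f m z.1 z.2)
  convex : ∀ m y, ConvexOn ℝ Set.univ (fun x => f m x y)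
  concave : ∀ m x, ConcaveOn ℝ Set.univ (fun y => f m x y)
  smooth : ∀ z₁ z₂, ‖globalOp f z₁ - globalOp f z₂‖ ≤ L * ‖z₁ - z₂‖
  localSmooth : ∃ Lmax : ℝ, ∀ m z₁ z₂,
    ‖saddleOp (f m) z₁ - saddleOp (f m) z₂‖ ≤ Lmax * ‖z₁ - z₂‖
  strong : ∀ z₁ z₂, μ * ‖z₁ - z₂‖ ^ 2 ≤ inner ℝ (globalOp f z₁ - globalOp f z₂) (z₁ - z₂)

/-! ### Slowly time-varying networks and gossip matrices -/

/-- Consecutive graphs differ in at most two edges (added and removed edges together). -/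
def SlowlyVarying {M : ℕ} (G : ℕ → SimpleGraph (Fin M)) : Prop :=
  ∀ k, (symmDiff (G k).edgeSet (G (k + 1)).edgeSet).ncard ≤ 2

/-- `W` is a gossip matrix for the graph `G`. -/
structure IsGossip {M : ℕ} (G : SimpleGraph (Fin M)) (W : Matrix (Fin M) (Fin M) ℝ) :
    Prop where
  posSemidef : W.PosSemidef
  support : ∀ i j, i ≠ j → ¬ G.Adj i j → W i j = 0
  ker : LinearMap.ker (Matrix.toLin' W) = Submodule.span ℝ {fun _ => (1 : ℝ)}

/-- The set of (real) eigenvalues of `W`. -/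
def eigenvalueSet {M : ℕ} (W : Matrix (Fin M) (Fin M) ℝ) : Set ℝ :=
  {a | Module.End.HasEigenvalue (Matrix.toLin' W) a}

/-- The condition number `λ_max (W) / λ_min⁺ (W)`: the largest eigenvalue over the smallest
positive one. -/
def condNumber {M : ℕ} (W : Matrix (Fin M) (Fin M) ℝ) : ℝ :=
  sSup (eigenvalueSet W) / sInf {a | a ∈ eigenvalueSet W ∧ 0 < a}

/-- The network `G` with gossip matrices `W` changes at most two edges per round and has
condition number `χ = sup_k λ_max (W^k) / λ_min⁺ (W^k)`. -/
structure IsSlowNetwork {M : ℕ} (G : ℕ → SimpleGraph (Fin M))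
    (W : ℕ → Matrix (Fin M) (Fin M) ℝ) (χ : ℝ) : Prop where
  slow : SlowlyVarying G
  gossip : ∀ k, IsGossip (G k) (W k)
  cond : IsLUB (Set.range fun k => condNumber (W k)) χ

/-! ### Black-box procedures -/

/-- The local memories of the `M` nodes, for the `x`- and for the `y`-variables. -/
structure Memory (M n : ℕ) where
  x : Fin M → Set (EucSpace n)
  y : Fin M → Set (EucSpace n)

/-- Initially every memory is `{0}`. -/
def Memory.initial (M n : ℕ) : Memory M n := ⟨fun _ => {0}, fun _ => {0}⟩

/-- One local iteration: every node `m` adds to its memories finitely many points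
`x ∈ span {x', ∇_x f_m (x'', y'')}` and `y ∈ span {y', ∇_y f_m (x'', y'')}`, where
`x', x''` and `y', y''` already are in its memories. -/
def LocalStep {M n : ℕ} (f : Fin M → EucSpace n → EucSpace n → ℝ) (S S' : Memory M n) :
    Prop :=
  ∀ m, ∃ P Q : Finset (EucSpace n),
    S'.x m = S.x m ∪ (P : Set (EucSpace n)) ∧
    S'.y m = S.y m ∪ (Q : Set (EucSpace n)) ∧
    (∀ p ∈ P, ∃ x' ∈ S.x m, ∃ x'' ∈ S.x m, ∃ y'' ∈ S.y m,
      p ∈ Submodule.span ℝ {x', gradX (f m) x'' y''}) ∧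
    (∀ p ∈ Q, ∃ y' ∈ S.y m, ∃ x'' ∈ S.x m, ∃ y'' ∈ S.y m,
      p ∈ Submodule.span ℝ {y', gradY (f m) x'' y''})

/-- One communication round over the graph `G`: the new memory of a node lies in the span of
the memories of its neighbours and of its own memory. Only an inclusion is asked for, so that
a node may send, keep or discard whatever it likes; this covers the update which sets the
memory equal to the span over the neighbours, with or without the node itself. -/
def CommStep {M n : ℕ} (G : SimpleGraph (Fin M)) (S S' : Memory M n) : Prop :=
  ∀ m,
    S'.x m ⊆ Submodule.span ℝ (⋃ i ∈ {i | i = m ∨ G.Adj i m}, S.x i) ∧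
    S'.y m ⊆ Submodule.span ℝ (⋃ i ∈ {i | i = m ∨ G.Adj i m}, S.y i)

/-- `BBPReaches f G T K S`: some black-box procedure has the memories `S` after `T` local
iterations and `K` communication rounds, interleaved in any order. The communication round
with number `k` (counted from `0`) uses the graph `G k`. -/
inductive BBPReaches {M n : ℕ} (f : Fin M → EucSpace n → EucSpace n → ℝ)
    (G : ℕ → SimpleGraph (Fin M)) : ℕ → ℕ → Memory M n → Prop
  | init : BBPReaches f G 0 0 (Memory.initial M n)
  | localStep {T K : ℕ} {S S' : Memory M n} :
      BBPReaches f G T K S → LocalStep f S S' → BBPReaches f G (T + 1) K S'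
  | commStep {T K : ℕ} {S S' : Memory M n} :
      BBPReaches f G T K S → CommStep (G K) S S' → BBPReaches f G T (K + 1) S'

/-- `(x, y)` is a possible output after `T` local iterations and `K` communication rounds. -/
def BBPOutput {M n : ℕ} (f : Fin M → EucSpace n → EucSpace n → ℝ)
    (G : ℕ → SimpleGraph (Fin M)) (T K : ℕ) (x y : EucSpace n) : Prop :=
  ∃ S : Memory M n, BBPReaches f G T K S ∧
    x ∈ Submodule.span ℝ (⋃ m, S.x m) ∧ y ∈ Submodule.span ℝ (⋃ m, S.y m)

end

/-! Two nodes `l` and `r` hide a chain y₀, x₀, y₁, x₁, …; every other node holds only the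
regularising quadratics. Node `l` has the linear term at y₀ and the links from xᵢ to yᵢ₊₁; node `r`
has the links from yᵢ to xᵢ and a boundary term at the end. Starting from zero memories, coordinates
appear in chain order, and consecutive ones must be produced alternately by `l` and `r`
(`preservesLevel_chainFun`). So one local iteration raises the level of the memories by at most one
(`BBPReaches.levelLE_iterations`), and every new coordinate after the first needs information to
cross between `l` and `r`.

The saddle point is geometric along the chain, with ratio ρ solving βρ² + μρ = β. Hence -log ρ ≤
μ/β, and an output of level k still misses y* by about ρ^(k+1) ‖y*‖ (`norm_sub_geomVec_ge`). With β
= (L - μ)/3 this forces a level of order (L/μ) log(‖y*‖²/ε), which is the bound on `T`.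

For `K` each crossing must cost about χ rounds. The nodes `l`, `r` are the hubs of a double star
with D further nodes, the movers; exactly one mover, the bridge, touches both hubs, and it changes
in step with the information. Whatever hub `l` sends to the bridge is stuck there: in the next round
that mover is a leaf at `l`. Only after D rounds is the supply of movers used up, and the next sweep
goes backwards for the opposite direction (`isBarrier_moverWeight`,
`BBPReaches.levelLE_barrierLevel`). Bridge edges of weight D keep the spectral gap above a constant
while the top eigenvalue stays O(D), so D can be proportional to χ; three pendant nodes tune the
condition number to be exactly χ (`isSlowNetwork_moverWeight`). -/

noncomputable section

/-! ### Quadratic chain functions: convexity, gradients, regularity. -/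

/-- The function held by a node of the network: `S` is the shift of the chain. -/
def chainFun {E : Type*} [NormedAddCommGroup E] [InnerProductSpace ℝ E]
    (S : E →L[ℝ] E) (e₀ e₁ : E) (μ β ρ b p q : ℝ) (x y : E) : ℝ :=
  μ / 2 * ‖x‖ ^ 2 - μ / 2 * ‖y‖ ^ 2 + q * (β * inner ℝ x (S y) + b * inner ℝ e₀ y)
    + p * (-β * inner ℝ x y + β * ρ / 2 * inner ℝ e₁ x ^ 2)

section
variable {E : Type*} [NormedAddCommGroup E] [InnerProductSpace ℝ E]
  (S S' : E →L[ℝ] E) (e₀ e₁ : E) (μ β ρ b p q : ℝ)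

/-- The couplings are affine in x, so the convexity defect is exactly s(1 - s) times the quadratic
part evaluated at x - x'. -/
lemma chainFun_convexOn (hμ : 0 ≤ μ) (hβ : 0 ≤ β) (hρ : 0 ≤ ρ) (hp : 0 ≤ p) (y : E) :
    ConvexOn ℝ Set.univ (fun x => chainFun S e₀ e₁ μ β ρ b p q x y) := by
  refine ⟨convex_univ, fun x _ x' _ s t hs ht hst => ?_⟩
  obtain rfl : t = 1 - s := by linarith
  have h : s * chainFun S e₀ e₁ μ β ρ b p q x y + (1 - s) * chainFun S e₀ e₁ μ β ρ b p q x' y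
      - chainFun S e₀ e₁ μ β ρ b p q (s • x + (1 - s) • x') y
      = s * (1 - s) * (μ / 2 * ‖x - x'‖ ^ 2 + p * (β * ρ / 2 * inner ℝ e₁ (x - x') ^ 2)) := by
    simp only [chainFun, ← real_inner_self_eq_norm_sq, inner_add_left, inner_add_right,
      inner_smul_left, inner_smul_right, inner_sub_left, inner_sub_right, real_inner_comm x x',
      RCLike.conj_to_real]
    ring
  have h2 : 0 ≤ s * (1 - s) * (μ / 2 * ‖x - x'‖ ^ 2
      + p * (β * ρ / 2 * inner ℝ e₁ (x - x') ^ 2)) := by positivity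
  simp only [smul_eq_mul]
  linarith

lemma chainFun_concaveOn (hμ : 0 ≤ μ) (x : E) :
    ConcaveOn ℝ Set.univ (fun y => chainFun S e₀ e₁ μ β ρ b p q x y) := by
  refine ⟨convex_univ, fun y _ y' _ s t hs ht hst => ?_⟩
  obtain rfl : t = 1 - s := by linarith
  have h : chainFun S e₀ e₁ μ β ρ b p q x (s • y + (1 - s) • y')
      - (s * chainFun S e₀ e₁ μ β ρ b p q x y + (1 - s) * chainFun S e₀ e₁ μ β ρ b p q x y')
      = s * (1 - s) * (μ / 2 * ‖y - y'‖ ^ 2) := by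
    simp only [chainFun, ← real_inner_self_eq_norm_sq, inner_add_left, inner_add_right, map_add,
      map_smul, inner_smul_left, inner_smul_right, inner_sub_left, inner_sub_right,
      real_inner_comm y y', RCLike.conj_to_real]
    ring
  have h2 : 0 ≤ s * (1 - s) * (μ / 2 * ‖y - y'‖ ^ 2) := by positivity
  simp only [smul_eq_mul]
  linarith

lemma chainFun_differentiable :
    Differentiable ℝ (fun z : E × E => chainFun S e₀ e₁ μ β ρ b p q z.1 z.2) := by
  unfold chainFun
  have h1 : Differentiable ℝ fun z : E × E => ‖z.1‖ ^ 2 := differentiable_fst.norm_sq ℝ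
  have h2 : Differentiable ℝ fun z : E × E => ‖z.2‖ ^ 2 := differentiable_snd.norm_sq ℝ
  have h3 : Differentiable ℝ fun z : E × E => (inner ℝ z.1 (S z.2) : ℝ) :=
    differentiable_fst.inner ℝ (S.differentiable.comp differentiable_snd)
  have h4 : Differentiable ℝ fun z : E × E => (inner ℝ e₀ z.2 : ℝ) :=
    (differentiable_const e₀).inner ℝ differentiable_snd
  have h5 : Differentiable ℝ fun z : E × E => (inner ℝ z.1 z.2 : ℝ) :=
    differentiable_fst.inner ℝ differentiable_snd
  have h6 : Differentiable ℝ fun z : E × E => (inner ℝ e₁ z.1 : ℝ) :=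
    (differentiable_const e₁).inner ℝ differentiable_fst
  fun_prop

lemma hasGradientAt_of_quadratic [CompleteSpace E] {g : E → ℝ} {v x : E} {C : ℝ}
    (h : ∀ d, |g (x + d) - g x - inner ℝ v d| ≤ C * ‖d‖ ^ 2) : HasGradientAt g v x := by
  rw [hasGradientAt_iff_isLittleO_nhds_zero]
  refine Asymptotics.IsBigO.trans_isLittleO (g := fun d : E => ‖d‖ ^ 2)
    (Asymptotics.IsBigO.of_bound C (Filter.Eventually.of_forall fun d => ?_)) ?_
  · simpa using h d
  · exact Asymptotics.isLittleO_norm_pow_id one_lt_two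

variable [CompleteSpace E]

lemma chainFun_hasGradientAt_left (x y : E) :
    HasGradientAt (fun x => chainFun S e₀ e₁ μ β ρ b p q x y)
      (μ • x + (q * β) • S y - (p * β) • y + (p * β * ρ * inner ℝ e₁ x) • e₁) x := by
  refine hasGradientAt_of_quadratic (C := |μ / 2| + |p * β * ρ / 2| * ‖e₁‖ ^ 2) fun d => ?_
  have h : chainFun S e₀ e₁ μ β ρ b p q (x + d) y - chainFun S e₀ e₁ μ β ρ b p q x y
      - inner ℝ (μ • x + (q * β) • S y - (p * β) • y + (p * β * ρ * inner ℝ e₁ x) • e₁) d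
      = μ / 2 * ‖d‖ ^ 2 + p * β * ρ / 2 * (inner ℝ e₁ d) ^ 2 := by
    simp only [chainFun, ← real_inner_self_eq_norm_sq, inner_add_left, inner_add_right,
      inner_smul_left, inner_sub_left, RCLike.conj_to_real, real_inner_comm d x,
      real_inner_comm d y, real_inner_comm d (S y)]
    ring
  rw [h]
  have h1 : (inner ℝ e₁ d : ℝ) ^ 2 ≤ ‖e₁‖ ^ 2 * ‖d‖ ^ 2 := by
    rw [← mul_pow, ← sq_abs]
    gcongr
    exact abs_real_inner_le_norm _ _
  calc _ ≤ |μ / 2 * ‖d‖ ^ 2| + |p * β * ρ / 2 * (inner ℝ e₁ d) ^ 2| := abs_add_le _ _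
    _ = |μ / 2| * ‖d‖ ^ 2 + |p * β * ρ / 2| * (inner ℝ e₁ d) ^ 2 := by
        rw [abs_mul, abs_mul, abs_sq, abs_sq]
    _ ≤ |μ / 2| * ‖d‖ ^ 2 + |p * β * ρ / 2| * (‖e₁‖ ^ 2 * ‖d‖ ^ 2) := by gcongr
    _ = _ := by ring

lemma chainFun_hasGradientAt_right (hS : ∀ x y, inner ℝ x (S y) = (inner ℝ (S' x) y : ℝ))
    (x y : E) :
    HasGradientAt (fun y => chainFun S e₀ e₁ μ β ρ b p q x y)
      (-(μ • y) + (q * β) • S' x + (q * b) • e₀ - (p * β) • x) y := by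
  refine hasGradientAt_of_quadratic (C := |μ / 2|) fun d => ?_
  have h : chainFun S e₀ e₁ μ β ρ b p q x (y + d) - chainFun S e₀ e₁ μ β ρ b p q x y
      - inner ℝ (-(μ • y) + (q * β) • S' x + (q * b) • e₀ - (p * β) • x) d
      = -(μ / 2 * ‖d‖ ^ 2) := by
    simp only [chainFun, ← real_inner_self_eq_norm_sq, inner_add_left, inner_add_right, map_add,
      inner_smul_left, inner_sub_left, inner_neg_left, RCLike.conj_to_real, hS,
      real_inner_comm d y]
    ring
  rw [h, abs_neg, abs_mul, abs_sq]

end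

section
variable {n : ℕ} (S S' : EucSpace n →L[ℝ] EucSpace n) (e₀ e₁ : EucSpace n)
  (μ β ρ b p q : ℝ)

lemma gradX_chainFun (x y : EucSpace n) :
    gradX (chainFun S e₀ e₁ μ β ρ b p q) x y =
      μ • x + (q * β) • S y - (p * β) • y + (p * β * ρ * inner ℝ e₁ x) • e₁ :=
  (chainFun_hasGradientAt_left S e₀ e₁ μ β ρ b p q x y).gradient

lemma gradY_chainFun (hS : ∀ x y, inner ℝ x (S y) = (inner ℝ (S' x) y : ℝ))
    (x y : EucSpace n) :
    gradY (chainFun S e₀ e₁ μ β ρ b p q) x y =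
      -(μ • y) + (q * β) • S' x + (q * b) • e₀ - (p * β) • x :=
  (chainFun_hasGradientAt_right S S' e₀ e₁ μ β ρ b p q hS x y).gradient

lemma saddleOp_chainFun_sub (hS : ∀ x y, inner ℝ x (S y) = (inner ℝ (S' x) y : ℝ))
    (z w : WithLp 2 (EucSpace n × EucSpace n)) :
    saddleOp (chainFun S e₀ e₁ μ β ρ b p q) z - saddleOp (chainFun S e₀ e₁ μ β ρ b p q) w =
      μ • (z - w) + (q * β) • WithLp.toLp 2 (S (z - w).snd, -S' (z - w).fst)
      + (p * β) • WithLp.toLp 2 (-(z - w).snd, (z - w).fst)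
      + WithLp.toLp 2 ((p * β * ρ * inner ℝ e₁ (z - w).fst) • e₁, 0) := by
  apply (WithLp.equiv 2 _).injective
  simp only [saddleOp, gradX_chainFun, gradY_chainFun S S' e₀ e₁ μ β ρ b p q hS]
  refine Prod.ext ?_ ?_
  · simp [smul_sub, inner_sub_right, mul_sub, sub_smul]
    abel
  · simp [smul_sub]
    abel

lemma norm_toLp_prod_le {E F : Type*} [SeminormedAddCommGroup E] [SeminormedAddCommGroup F]
    {x x' : E} {y y' : F}
    (hx : ‖x‖ ≤ ‖x'‖) (hy : ‖y‖ ≤ ‖y'‖) :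
    ‖WithLp.toLp 2 (x, y)‖ ≤ ‖WithLp.toLp 2 (x', y')‖ := by
  simp only [WithLp.prod_norm_eq_of_L2]
  exact Real.sqrt_le_sqrt (add_le_add (pow_le_pow_left₀ (norm_nonneg _) hx 2)
    (pow_le_pow_left₀ (norm_nonneg _) hy 2))

/-- The factor 2 at `p` counts the identity coupling and the boundary term; the latter has norm at
most pβ because ρ ≤ 1. -/
lemma norm_saddleOp_chainFun_sub_le (hS : ∀ x y, inner ℝ x (S y) = (inner ℝ (S' x) y : ℝ))
    (hS1 : ∀ x, ‖S x‖ ≤ ‖x‖) (hS1' : ∀ x, ‖S' x‖ ≤ ‖x‖) (he : ‖e₁‖ ≤ 1) (hμ : 0 ≤ μ)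
    (hβ : 0 ≤ β) (hρ : 0 ≤ ρ) (hρ1 : ρ ≤ 1) (hp : 0 ≤ p) (hq : 0 ≤ q)
    (z w : WithLp 2 (EucSpace n × EucSpace n)) :
    ‖saddleOp (chainFun S e₀ e₁ μ β ρ b p q) z - saddleOp (chainFun S e₀ e₁ μ β ρ b p q) w‖
      ≤ (μ + q * β + 2 * (p * β)) * ‖z - w‖ := by
  rw [saddleOp_chainFun_sub S S' e₀ e₁ μ β ρ b p q hS]
  set d := z - w
  have hd' : ‖WithLp.toLp 2 (d.snd, d.fst)‖ = ‖d‖ := by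
    simp only [WithLp.prod_norm_eq_of_L2]
    rw [add_comm]
    rfl
  have h1 : ‖WithLp.toLp 2 (S d.snd, -S' d.fst)‖ ≤ ‖d‖ := by
    rw [← hd']
    exact norm_toLp_prod_le (hS1 _) (by simpa using hS1' _)
  have h2 : ‖WithLp.toLp 2 (-d.snd, d.fst)‖ ≤ ‖d‖ := by
    rw [← hd']
    exact norm_toLp_prod_le (by simp) le_rfl
  have hfst : ‖d.fst‖ ≤ ‖d‖ := by
    rw [WithLp.prod_norm_eq_of_L2]
    exact Real.le_sqrt_of_sq_le (by nlinarith [sq_nonneg ‖d.snd‖])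
  have h3 : ‖WithLp.toLp 2 ((p * β * ρ * inner ℝ e₁ d.fst) • e₁, (0 : EucSpace n))‖
      ≤ (p * β) * ‖d‖ := by
    have : ‖(inner ℝ e₁ d.fst : ℝ)‖ ≤ 1 * ‖d‖ :=
      (norm_inner_le_norm _ _).trans (by gcongr)
    calc ‖WithLp.toLp 2 ((p * β * ρ * inner ℝ e₁ d.fst) • e₁, (0 : EucSpace n))‖
        = ‖(p * β * ρ * inner ℝ e₁ d.fst) • e₁‖ := by simp
      _ = p * β * ρ * ‖(inner ℝ e₁ d.fst : ℝ)‖ * ‖e₁‖ := by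
          rw [norm_smul, norm_mul, Real.norm_of_nonneg (by positivity)]
      _ ≤ p * β * 1 * (1 * ‖d‖) * 1 := by gcongr
      _ = _ := by ring
  calc _ ≤ ‖μ • d‖ + ‖(q * β) • WithLp.toLp 2 (S d.snd, -S' d.fst)‖
        + ‖(p * β) • WithLp.toLp 2 (-d.snd, d.fst)‖
        + ‖WithLp.toLp 2 ((p * β * ρ * inner ℝ e₁ d.fst) • e₁, (0 : EucSpace n))‖ :=
        norm_add₄_le
    _ ≤ μ * ‖d‖ + (q * β) * ‖d‖ + (p * β) * ‖d‖ + (p * β) * ‖d‖ := by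
        rw [norm_smul, norm_smul, norm_smul, Real.norm_of_nonneg hμ,
          Real.norm_of_nonneg (by positivity : 0 ≤ q * β),
          Real.norm_of_nonneg (by positivity : 0 ≤ p * β)]
        gcongr
    _ = _ := by ring

/-- Both couplings are skew and drop out of the inner product; what remains besides the μ-term is
the square from the boundary. -/
lemma inner_saddleOp_chainFun_sub_ge (hS : ∀ x y, inner ℝ x (S y) = (inner ℝ (S' x) y : ℝ))
    (hβ : 0 ≤ β) (hρ : 0 ≤ ρ) (hp : 0 ≤ p) (z w : WithLp 2 (EucSpace n × EucSpace n)) :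
    μ * ‖z - w‖ ^ 2 ≤ inner ℝ (saddleOp (chainFun S e₀ e₁ μ β ρ b p q) z
      - saddleOp (chainFun S e₀ e₁ μ β ρ b p q) w) (z - w) := by
  rw [saddleOp_chainFun_sub S S' e₀ e₁ μ β ρ b p q hS]
  set d := z - w
  have h : inner ℝ (μ • d + (q * β) • WithLp.toLp 2 (S d.snd, -S' d.fst)
      + (p * β) • WithLp.toLp 2 (-d.snd, d.fst)
      + WithLp.toLp 2 ((p * β * ρ * inner ℝ e₁ d.fst) • e₁, (0 : EucSpace n))) d
      = μ * ‖d‖ ^ 2 + p * β * ρ * (inner ℝ e₁ d.fst) ^ 2 := by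
    have h1 : d.ofLp.1 = d.fst := rfl
    have h2 : d.ofLp.2 = d.snd := rfl
    simp only [inner_add_left, inner_smul_left, WithLp.prod_inner_apply, RCLike.conj_to_real,
      inner_neg_left, inner_zero_left, real_inner_self_eq_norm_sq, ← hS, h1, h2,
      WithLp.prod_norm_sq_eq_of_L2]
    rw [real_inner_comm d.fst (S d.snd), real_inner_comm d.fst d.snd]
    ring
  rw [h]
  have : 0 ≤ p * β * ρ * (inner ℝ e₁ d.fst : ℝ) ^ 2 := by positivity
  linarith

variable {M : ℕ} (P Q : Fin M → ℝ)

lemma globalObjective_chainFun (hM : (M : ℝ) ≠ 0) (hP : ∑ m, P m = M) (hQ : ∑ m, Q m = M) :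
    globalObjective (fun m => chainFun S e₀ e₁ μ β ρ b (P m) (Q m))
      = chainFun S e₀ e₁ μ β ρ b 1 1 := by
  funext x y
  simp only [globalObjective, chainFun, Finset.sum_add_distrib, ← Finset.sum_mul, hP, hQ,
    Finset.sum_const, Finset.card_univ, Fintype.card_fin, nsmul_eq_mul]
  field_simp

lemma globalOp_chainFun (hS : ∀ x y, inner ℝ x (S y) = (inner ℝ (S' x) y : ℝ))
    (hM : (M : ℝ) ≠ 0) (hP : ∑ m, P m = M) (hQ : ∑ m, Q m = M) :
    globalOp (fun m => chainFun S e₀ e₁ μ β ρ b (P m) (Q m))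
      = saddleOp (chainFun S e₀ e₁ μ β ρ b 1 1) := by
  -- The operator is affine in (p, q), so averaging over the nodes replaces both weights by their
  -- mean 1.
  have key : ∀ p q z, saddleOp (chainFun S e₀ e₁ μ β ρ b p q) z =
      μ • z + q • WithLp.toLp 2 (β • S z.snd, -(β • S' z.fst) - b • e₀)
      + p • WithLp.toLp 2 (-(β • z.snd) + (β * ρ * inner ℝ e₁ z.fst) • e₁, β • z.fst) := by
    intro p q z
    apply (WithLp.equiv 2 _).injective
    simp only [saddleOp, gradX_chainFun, gradY_chainFun S S' e₀ e₁ μ β ρ b p q hS]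
    refine Prod.ext ?_ ?_
    · simp [smul_smul, mul_assoc]
      abel
    · simp [smul_smul, smul_sub]
      abel
  funext z
  simp only [globalOp, key, Finset.sum_add_distrib, ← Finset.sum_smul, hP, hQ, smul_add, smul_smul,
    Finset.sum_const, Finset.card_univ, Fintype.card_fin, ← Nat.cast_smul_eq_nsmul ℝ,
    one_div_mul_cancel hM]
  rw [smul_eq_mul, ← mul_assoc, one_div_mul_cancel hM, one_mul]

lemma isSaddleProblem_chainFun (hS : ∀ x y, inner ℝ x (S y) = (inner ℝ (S' x) y : ℝ))
    (hS1 : ∀ x, ‖S x‖ ≤ ‖x‖) (hS1' : ∀ x, ‖S' x‖ ≤ ‖x‖) (he : ‖e₁‖ ≤ 1) (hμ : 0 ≤ μ)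
    (hβ : 0 ≤ β) (hρ : 0 ≤ ρ) (hρ1 : ρ ≤ 1) (hM : (M : ℝ) ≠ 0) (hP : ∑ m, P m = M)
    (hQ : ∑ m, Q m = M) (hP0 : ∀ m, 0 ≤ P m) (hQ0 : ∀ m, 0 ≤ Q m) :
    IsSaddleProblem (fun m => chainFun S e₀ e₁ μ β ρ b (P m) (Q m)) (μ + 3 * β) μ where
  differentiable m := chainFun_differentiable _ _ _ _ _ _ _ _ _
  convex m y := chainFun_convexOn _ _ _ _ _ _ _ _ _ hμ hβ hρ (hP0 m) y
  concave m x := chainFun_concaveOn _ _ _ _ _ _ _ _ _ hμ x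
  smooth z w := by
    rw [globalOp_chainFun S S' e₀ e₁ μ β ρ b P Q hS hM hP hQ]
    refine (norm_saddleOp_chainFun_sub_le S S' e₀ e₁ μ β ρ b 1 1 hS hS1 hS1' he hμ hβ hρ hρ1
      zero_le_one zero_le_one z w).trans_eq ?_
    ring
  localSmooth := by
    refine ⟨μ + M * β + 2 * (M * β), fun m z w => ?_⟩
    refine (norm_saddleOp_chainFun_sub_le S S' e₀ e₁ μ β ρ b _ _ hS hS1 hS1' he hμ hβ hρ hρ1
      (hP0 m) (hQ0 m) z w).trans ?_
    have h1 : P m ≤ M := hP ▸ Finset.single_le_sum (fun i _ => hP0 i) (Finset.mem_univ m)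
    have h2 : Q m ≤ M := hQ ▸ Finset.single_le_sum (fun i _ => hQ0 i) (Finset.mem_univ m)
    gcongr
  strong z w := by
    rw [globalOp_chainFun S S' e₀ e₁ μ β ρ b P Q hS hM hP hQ]
    exact inner_saddleOp_chainFun_sub_ge S S' e₀ e₁ μ β ρ b 1 1 hS hβ hρ zero_le_one z w

lemma isSaddlePointOn_chainFun (hS : ∀ x y, inner ℝ x (S y) = (inner ℝ (S' x) y : ℝ))
    (hμ : 0 ≤ μ) (hβ : 0 ≤ β) (hρ : 0 ≤ ρ) {x y : EucSpace n}
    (hx : μ • x + β • S y - β • y + (β * ρ * inner ℝ e₁ x) • e₁ = 0)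
    (hy : -(μ • y) + β • S' x + b • e₀ - β • x = 0) :
    IsSaddlePointOn Set.univ Set.univ (chainFun S e₀ e₁ μ β ρ b 1 1) x y := by
  intro x' _ y' _
  have h1 : chainFun S e₀ e₁ μ β ρ b 1 1 x' y - chainFun S e₀ e₁ μ β ρ b 1 1 x y
      = inner ℝ (μ • x + β • S y - β • y + (β * ρ * inner ℝ e₁ x) • e₁) (x' - x)
        + μ / 2 * ‖x' - x‖ ^ 2 + β * ρ / 2 * (inner ℝ e₁ (x' - x)) ^ 2 := by
    simp only [chainFun, ← real_inner_self_eq_norm_sq, inner_add_left, inner_sub_right,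
      inner_smul_left, inner_sub_left, RCLike.conj_to_real, real_inner_comm x' x,
      real_inner_comm (S y), real_inner_comm y]
    ring
  have h2 : chainFun S e₀ e₁ μ β ρ b 1 1 x y' - chainFun S e₀ e₁ μ β ρ b 1 1 x y
      = inner ℝ (-(μ • y) + β • S' x + b • e₀ - β • x) (y' - y) - μ / 2 * ‖y' - y‖ ^ 2 := by
    simp only [chainFun, ← real_inner_self_eq_norm_sq, inner_add_left, inner_sub_right,
      inner_smul_left, inner_sub_left, RCLike.conj_to_real, inner_neg_left, hS,
      real_inner_comm y' y]
    ring
  rw [hx, inner_zero_left] at h1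
  rw [hy, inner_zero_left] at h2
  have h3 : 0 ≤ μ / 2 * ‖x' - x‖ ^ 2 := by positivity
  have h4 : 0 ≤ β * ρ / 2 * (inner ℝ e₁ (x' - x) : ℝ) ^ 2 := by positivity
  have h5 : 0 ≤ μ / 2 * ‖y' - y‖ ^ 2 := by positivity
  linarith

end

/-! ### Shifts, chain levels and the geometric saddle point. -/

/-- The left shift `(y₀, y₁, …) ↦ (y₁, y₂, …, 0)`. -/
def leftShift (m : ℕ) : EucSpace (m + 1) →L[ℝ] EucSpace (m + 1) :=
  LinearMap.toContinuousLinearMap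
    { toFun := fun y => WithLp.toLp 2 (Fin.snoc (α := fun _ => ℝ) (fun i : Fin m => y i.succ) 0)
      map_add' := fun y y' => by
        ext i
        refine Fin.lastCases ?_ (fun j => ?_) i <;> simp
      map_smul' := fun c y => by
        ext i
        refine Fin.lastCases ?_ (fun j => ?_) i <;> simp }

/-- The right shift `(x₀, x₁, …) ↦ (0, x₀, x₁, …)`. -/
def rightShift (m : ℕ) : EucSpace (m + 1) →L[ℝ] EucSpace (m + 1) :=
  LinearMap.toContinuousLinearMap
    { toFun := fun x => WithLp.toLp 2 (Fin.cons (α := fun _ => ℝ) 0 (fun i : Fin m => x i.castSucc))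
      map_add' := fun x x' => by
        ext i
        refine Fin.cases ?_ (fun j => ?_) i <;> simp
      map_smul' := fun c x => by
        ext i
        refine Fin.cases ?_ (fun j => ?_) i <;> simp }

section shift
variable {m : ℕ} (x y : EucSpace (m + 1))

@[simp] lemma leftShift_castSucc (i : Fin m) : leftShift m y i.castSucc = y i.succ := by
  simp [leftShift]

@[simp] lemma leftShift_last : leftShift m y (Fin.last m) = 0 := by
  simp [leftShift]

@[simp] lemma rightShift_zero : rightShift m x 0 = 0 := by
  simp [rightShift]

@[simp] lemma rightShift_succ (i : Fin m) : rightShift m x i.succ = x i.castSucc := by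
  simp [rightShift]

lemma inner_leftShift : inner ℝ x (leftShift m y) = (inner ℝ (rightShift m x) y : ℝ) := by
  simp only [PiLp.inner_apply]
  rw [Fin.sum_univ_castSucc, Fin.sum_univ_succ]
  simp

lemma norm_leftShift_le : ‖leftShift m y‖ ≤ ‖y‖ := by
  rw [EuclideanSpace.norm_eq, EuclideanSpace.norm_eq]
  refine Real.sqrt_le_sqrt ?_
  rw [Fin.sum_univ_castSucc, Fin.sum_univ_succ]
  simp [sq_nonneg]

lemma norm_rightShift_le : ‖rightShift m x‖ ≤ ‖x‖ := by
  rw [EuclideanSpace.norm_eq, EuclideanSpace.norm_eq]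
  refine Real.sqrt_le_sqrt ?_
  rw [Fin.sum_univ_succ, Fin.sum_univ_castSucc]
  simp [sq_nonneg]

end shift

/-- In the chain `y₀, x₀, y₁, x₁, …`, the points `x` whose coordinates with chain index at
least `k` vanish. -/
def levelX (n k : ℕ) : Submodule ℝ (EucSpace n) where
  carrier := {x | ∀ i : Fin n, k ≤ 2 * (i : ℕ) + 1 → x i = 0}
  add_mem' ha hb i hi := by simp [ha i hi, hb i hi]
  zero_mem' i _ := rfl
  smul_mem' c x hx i hi := by simp [hx i hi]

/-- In the chain `y₀, x₀, y₁, x₁, …`, the points `y` whose coordinates with chain index at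
least `k` vanish. -/
def levelY (n k : ℕ) : Submodule ℝ (EucSpace n) where
  carrier := {y | ∀ i : Fin n, k ≤ 2 * (i : ℕ) → y i = 0}
  add_mem' ha hb i hi := by simp [ha i hi, hb i hi]
  zero_mem' i _ := rfl
  smul_mem' c x hx i hi := by simp [hx i hi]

lemma levelX_mono (n : ℕ) : Monotone (levelX n) := fun _ _ h _ hx i hi => hx i (h.trans hi)

lemma levelY_mono (n : ℕ) : Monotone (levelY n) := fun _ _ h _ hx i hi => hx i (h.trans hi)

/-- The gradients of `g` at points of level `k` are again of level `k`. -/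
def PreservesLevel {n : ℕ} (g : EucSpace n → EucSpace n → ℝ) (k : ℕ) : Prop :=
  ∀ x ∈ levelX n k, ∀ y ∈ levelY n k, gradX g x y ∈ levelX n k ∧ gradY g x y ∈ levelY n k

/-- The identity coupling joins chain indices 2i and 2i + 1, so it does not cross an even cut; the
shift joins 2i + 1 and 2i + 2, and the linear term creates index 0, so neither crosses an odd cut.
-/
lemma preservesLevel_chainFun {m k : ℕ} (μ β ρ b : ℝ) {p q : ℝ}
    (hp : p = 0 ∨ Even k) (hq : q = 0 ∨ Odd k) :
    PreservesLevel (chainFun (leftShift m) (EuclideanSpace.single 0 1)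
      (EuclideanSpace.single (Fin.last m) 1) μ β ρ b p q) k := by
  intro x hx y hy
  have hSy : leftShift m y ∈ levelX (m + 1) k := fun i => by
    refine Fin.lastCases (fun _ => ?_) (fun j hj => ?_) i
    · simp
    · rw [leftShift_castSucc]
      refine hy _ ?_
      simp only [Fin.val_castSucc, Fin.val_succ] at hj ⊢
      omega
  have hxY : x ∈ levelY (m + 1) k := fun i hi => hx i (by omega)
  rw [gradX_chainFun, gradY_chainFun _ (rightShift m) _ _ _ _ _ _ _ _ inner_leftShift]
  constructor
  · refine add_mem (sub_mem (add_mem (Submodule.smul_mem _ _ hx)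
      (Submodule.smul_mem _ _ hSy)) ?_) ?_
    · rcases hp with rfl | hp
      · simp
      · refine Submodule.smul_mem _ _ fun i hi => hy i ?_
        obtain ⟨t, rfl⟩ := hp
        omega
    · intro i hi
      by_cases h : i = Fin.last m
      · subst h
        simp [EuclideanSpace.inner_single_left, hx _ hi]
      · simp [h]
  · refine sub_mem (add_mem (add_mem (neg_mem (Submodule.smul_mem _ _ hy)) ?_) ?_)
      (Submodule.smul_mem _ _ hxY)
    · rcases hq with rfl | hq
      · simp
      · refine Submodule.smul_mem _ _ fun i => ?_
        refine Fin.cases (fun _ => ?_) (fun j hj => ?_) i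
        · simp
        · rw [rightShift_succ]
          refine hx _ ?_
          obtain ⟨t, rfl⟩ := hq
          simp only [Fin.val_castSucc, Fin.val_succ] at hj ⊢
          omega
    · rcases hq with rfl | hq
      · simp
      · refine Submodule.smul_mem _ _ fun i hi => ?_
        have : i ≠ 0 := by
          rintro rfl
          obtain ⟨t, rfl⟩ := hq
          simp at hi
        simp [this]

/-- The vector `(1, r, r², …)`. -/
def geomVec (n : ℕ) (r : ℝ) : EucSpace n := WithLp.toLp 2 fun i => r ^ (i : ℕ)

lemma geomVec_ne_zero (m : ℕ) (r : ℝ) : geomVec (m + 1) r ≠ 0 := by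
  intro h
  have := congrArg (fun v : EucSpace (m + 1) => v 0) h
  simp [geomVec] at this

/-- Away from the ends every stationarity equation is a multiple of `h`. The boundary term at the
last coordinate stands in for the missing next y, making the geometric sequence exact in finite
dimension; the coefficient of the linear term settles coordinate 0. -/
lemma isSaddlePointOn_geomVec (m : ℕ) {μ β ρ : ℝ} (s : ℝ) (hμ : 0 ≤ μ) (hβ : 0 ≤ β) (hρ : 0 ≤ ρ)
    (h : β * ρ ^ 2 + μ * ρ = β) :
    IsSaddlePointOn Set.univ Set.univ (chainFun (leftShift m) (EuclideanSpace.single 0 1)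
      (EuclideanSpace.single (Fin.last m) 1) μ β ρ (s * (μ + β * ρ)) 1 1)
      (ρ • s • geomVec (m + 1) (ρ ^ 2)) (s • geomVec (m + 1) (ρ ^ 2)) := by
  refine isSaddlePointOn_chainFun _ (rightShift m) _ _ _ _ _ _ inner_leftShift hμ hβ hρ ?_ ?_
  · ext i
    refine Fin.lastCases ?_ (fun j => ?_) i
    · simp [geomVec, EuclideanSpace.inner_single_left]
      linear_combination (s * (ρ ^ 2) ^ m) * h
    · have hj : j.castSucc ≠ Fin.last m := Fin.castSucc_ne_last j
      simp [geomVec, hj]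
      rw [pow_succ]
      linear_combination (s * (ρ ^ 2) ^ (j : ℕ)) * h
  · ext i
    refine Fin.cases ?_ (fun j => ?_) i
    · simp [geomVec]
      ring
    · simp [geomVec]
      rw [pow_succ]
      linear_combination -(s * ρ * (ρ ^ 2) ^ (j : ℕ)) * h

lemma sum_range_pow_le_two_mul {r : ℝ} (hr : 0 ≤ r) (hr1 : r ≤ 1) {n m : ℕ} (h : n ≤ 2 * m) :
    ∑ i ∈ Finset.range n, r ^ i ≤ 2 * ∑ i ∈ Finset.range m, r ^ i := by
  calc ∑ i ∈ Finset.range n, r ^ i ≤ ∑ i ∈ Finset.range (m + m), r ^ i :=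
        Finset.sum_le_sum_of_subset_of_nonneg (Finset.range_mono (by omega))
          fun i _ _ => by positivity
    _ = ∑ i ∈ Finset.range m, r ^ i + ∑ i ∈ Finset.range m, r ^ (m + i) :=
        Finset.sum_range_add _ _ _
    _ ≤ ∑ i ∈ Finset.range m, r ^ i + ∑ i ∈ Finset.range m, r ^ i := by
        exact add_le_add le_rfl (Finset.sum_le_sum fun i _ =>
          pow_le_pow_of_le_one hr hr1 (by omega))
    _ = _ := by ring

lemma norm_sub_geomVec_ge {n k : ℕ} {ρ : ℝ} (s : ℝ) (hρ : 0 ≤ ρ) (hρ1 : ρ ≤ 1) (hk : k + 1 ≤ n)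
    {y : EucSpace n} (hy : y ∈ levelY n k) :
    ρ ^ (2 * (k + 1)) * ‖s • geomVec n (ρ ^ 2)‖ ^ 2 ≤ 2 * ‖y - s • geomVec n (ρ ^ 2)‖ ^ 2 := by
  -- This is ⌈k/2⌉, the number of coordinates of `y` that level k allows to be nonzero. Since k + 1
  -- ≤ n it is at most n/2, so the n - h remaining powers, rescaled to start at 1, have at least
  -- half of the full sum.
  set h := (k + 1) / 2
  have e1 : ‖s • geomVec n (ρ ^ 2)‖ ^ 2 = s ^ 2 * ∑ i ∈ Finset.range n, (ρ ^ 4) ^ i := by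
    rw [EuclideanSpace.norm_sq_eq, ← Fin.sum_univ_eq_sum_range (fun i => (ρ ^ 4) ^ i),
      Finset.mul_sum]
    refine Finset.sum_congr rfl fun i _ => ?_
    simp only [geomVec, PiLp.smul_apply, smul_eq_mul, Real.norm_eq_abs, sq_abs]
    ring
  have e2 : ρ ^ (4 * h) * (s ^ 2 * ∑ i ∈ Finset.range (n - h), (ρ ^ 4) ^ i)
      ≤ ‖y - s • geomVec n (ρ ^ 2)‖ ^ 2 := by
    have : ∀ i : Fin n, (if h ≤ (i : ℕ) then s ^ 2 * (ρ ^ 4) ^ (i : ℕ) else 0)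
        ≤ ‖(y - s • geomVec n (ρ ^ 2)) i‖ ^ 2 := fun i => by
      split_ifs with hi
      · have := hy i (by omega)
        simp only [geomVec, PiLp.sub_apply, PiLp.smul_apply, this, smul_eq_mul, Real.norm_eq_abs,
          sq_abs]
        exact le_of_eq (by ring)
      · positivity
    rw [EuclideanSpace.norm_sq_eq]
    refine le_trans (le_of_eq ?_) (Finset.sum_le_sum fun i _ => this i)
    rw [Fin.sum_univ_eq_sum_range (fun i => if h ≤ i then s ^ 2 * (ρ ^ 4) ^ i else 0),
      ← Finset.sum_filter]
    have : (Finset.range n).filter (fun i => h ≤ i) = Finset.Ico h n := by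
      ext i
      simp [and_comm]
    rw [this, Finset.sum_Ico_eq_sum_range, Finset.mul_sum, Finset.mul_sum]
    refine Finset.sum_congr rfl fun i _ => ?_
    ring
  have e3 : ∑ i ∈ Finset.range n, (ρ ^ 4) ^ i ≤ 2 * ∑ i ∈ Finset.range (n - h), (ρ ^ 4) ^ i :=
    sum_range_pow_le_two_mul (by positivity) (pow_le_one₀ hρ hρ1) (by omega)
  have e4 : ρ ^ (2 * (k + 1)) ≤ ρ ^ (4 * h) := pow_le_pow_of_le_one hρ hρ1 (by omega)
  rw [e1]
  calc _ ≤ ρ ^ (4 * h) * (s ^ 2 * (2 * ∑ i ∈ Finset.range (n - h), (ρ ^ 4) ^ i)) := by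
        gcongr
    _ = 2 * (ρ ^ (4 * h) * (s ^ 2 * ∑ i ∈ Finset.range (n - h), (ρ ^ 4) ^ i)) := by ring
    _ ≤ _ := by gcongr

/-! ### Growth of levels along a black-box procedure. -/

/-- The memories of node `m` are of level `a m`. -/
def Memory.LevelLE {M n : ℕ} (S : Memory M n) (a : Fin M → ℕ) : Prop :=
  ∀ m, S.x m ⊆ levelX n (a m) ∧ S.y m ⊆ levelY n (a m)

section
variable {M n : ℕ} {S S' : Memory M n} {a a' : Fin M → ℕ}

lemma Memory.LevelLE.mono (h : S.LevelLE a) (ha : ∀ m, a m ≤ a' m) : S.LevelLE a' := fun m =>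
  ⟨(h m).1.trans (levelX_mono n (ha m)), (h m).2.trans (levelY_mono n (ha m))⟩

lemma Memory.initial_levelLE (a : Fin M → ℕ) : (Memory.initial M n).LevelLE a := fun m => by
  simp [Memory.initial]

lemma LocalStep.levelLE {f : Fin M → EucSpace n → EucSpace n → ℝ} (h : LocalStep f S S')
    (hS : S.LevelLE a) (hf : ∀ m, PreservesLevel (f m) (a m)) : S'.LevelLE a := by
  intro m
  obtain ⟨P, Q, hx, hy, hP, hQ⟩ := h m
  rw [hx, hy]
  refine ⟨Set.union_subset (hS m).1 fun v hv => ?_, Set.union_subset (hS m).2 fun v hv => ?_⟩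
  · obtain ⟨x', hx', x'', hx'', y'', hy'', hmem⟩ := hP v hv
    refine Submodule.span_le.2 ?_ hmem
    rintro w (rfl | rfl)
    · exact (hS m).1 hx'
    · exact (hf m _ ((hS m).1 hx'') _ ((hS m).2 hy'')).1
  · obtain ⟨x', hx', x'', hx'', y'', hy'', hmem⟩ := hQ v hv
    refine Submodule.span_le.2 ?_ hmem
    rintro w (rfl | rfl)
    · exact (hS m).2 hx'
    · exact (hf m _ ((hS m).1 hx'') _ ((hS m).2 hy'')).2

lemma CommStep.levelLE {G : SimpleGraph (Fin M)} (h : CommStep G S S')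
    (hS : S.LevelLE a) (ha : ∀ m, a m ≤ a' m) (ha' : ∀ i m, G.Adj i m → a i ≤ a' m) :
    S'.LevelLE a' := by
  intro m
  have key : ∀ i, i = m ∨ G.Adj i m → a i ≤ a' m := by
    rintro i (rfl | hi)
    · exact ha _
    · exact ha' _ _ hi
  refine ⟨(h m).1.trans (Submodule.span_le.2 (Set.iUnion₂_subset fun i hi => ?_)),
    (h m).2.trans (Submodule.span_le.2 (Set.iUnion₂_subset fun i hi => ?_))⟩
  · exact (hS i).1.trans (levelX_mono n (key i hi))
  · exact (hS i).2.trans (levelY_mono n (key i hi))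

/-- During each period of `D` rounds information does not pass from `l` to `r` (in the periods
of even number) or from `r` to `l` (in those of odd number): `A j i` is the set of the nodes
which may have been reached before round `i` of period `j`. -/
structure IsBarrier (G : ℕ → SimpleGraph (Fin M)) (D : ℕ) (l r : Fin M)
    (A : ℕ → ℕ → Set (Fin M)) : Prop where
  source : ∀ j i, i < D → (if Even j then l else r) ∈ A j i
  target : ∀ j i, i < D → (if Even j then r else l) ∉ A j i
  mono : ∀ j i, i + 1 < D → A j i ⊆ A j (i + 1)
  adj : ∀ j i, i + 1 < D → ∀ m ∈ A j i, ∀ m', (G (j * D + i)).Adj m m' → m' ∈ A j (i + 1)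

open Classical in
/-- A bound on the level of the memory of node `m` before communication round `K`. -/
def barrierLevel (D : ℕ) (A : ℕ → ℕ → Set (Fin M)) (K : ℕ) (m : Fin M) : ℕ :=
  K / D + if m ∈ A (K / D) (K % D) then 1 else 0

variable {f : Fin M → EucSpace n → EucSpace n → ℝ} {G : ℕ → SimpleGraph (Fin M)} {T K : ℕ}

lemma BBPReaches.levelLE_iterations (h : BBPReaches f G T K S)
    (hf : ∀ m k, PreservesLevel (f m) k ∨ PreservesLevel (f m) (k + 1)) :
    S.LevelLE fun _ => T := by
  induction h with
  | init => exact Memory.initial_levelLE _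
  | @localStep T K S S' _ hstep ih =>
    classical
    -- Each node may be regarded as being at whichever of the levels T, T + 1 its function
    -- preserves.
    have h1 : S'.LevelLE fun m => if PreservesLevel (f m) T then T else T + 1 := by
      refine hstep.levelLE (ih.mono fun m => ?_) fun m => ?_
      · split_ifs <;> omega
      · split_ifs with hm
        · exact hm
        · exact (hf m T).resolve_left hm
    refine h1.mono fun m => ?_
    split_ifs <;> omega
  | commStep _ hstep ih => exact hstep.levelLE ih (fun _ => le_rfl) fun _ _ _ => le_rfl

/-- In period j reached nodes have level at most j + 1 and the others at most j. The parity of j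
decides which of `l`, `r` is reached, exactly so that each sits at a level its function preserves;
local steps are therefore free. -/
lemma BBPReaches.levelLE_barrierLevel {D : ℕ} (hD : 0 < D) {l r : Fin M}
    {A : ℕ → ℕ → Set (Fin M)} (hA : IsBarrier G D l r A) (h : BBPReaches f G T K S)
    (hfl : ∀ m k, m ≠ l ∨ Odd k → m ≠ r ∨ Even k → PreservesLevel (f m) k) :
    S.LevelLE (barrierLevel D A K) := by
  induction h with
  | init => exact Memory.initial_levelLE _
  | @localStep T K S S' _ hstep ih =>
    refine hstep.levelLE ih fun m => ?_
    have hi := Nat.mod_lt K hD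
    have hs := hA.source (K / D) _ hi
    have ht := hA.target (K / D) _ hi
    unfold barrierLevel
    by_cases hm : m ∈ A (K / D) (K % D)
    · rw [if_pos hm]
      by_cases hj : Even (K / D)
      · rw [if_pos hj] at ht
        exact hfl _ _ (.inr hj.add_one) (.inl fun h => ht (h ▸ hm))
      · rw [if_neg hj] at ht
        exact hfl _ _ (.inl fun h => ht (h ▸ hm)) (.inr (Nat.not_even_iff_odd.1 hj).add_one)
    · rw [if_neg hm, add_zero]
      by_cases hj : Even (K / D)
      · rw [if_pos hj] at hs
        exact hfl _ _ (.inl fun h => hm (h ▸ hs)) (.inr hj)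
      · rw [if_neg hj] at hs
        exact hfl _ _ (.inr (Nat.not_even_iff_odd.1 hj)) (.inl fun h => hm (h ▸ hs))
  | @commStep T K S S' _ hstep ih =>
    have hle : ∀ m, barrierLevel D A K m ≤ K / D + 1 := fun m => by
      unfold barrierLevel
      split_ifs <;> omega
    have hi := Nat.mod_lt K hD
    have hK : K / D * D + K % D = K := Nat.div_add_mod' K D
    by_cases hlast : K % D + 1 < D
    · have h1 : (K + 1) / D = K / D := by
        rw [← hK, add_assoc, mul_comm, Nat.mul_add_div hD, Nat.div_eq_of_lt hlast,
          Nat.mul_add_div hD, Nat.div_eq_of_lt hi]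
      have h2 : (K + 1) % D = K % D + 1 := by
        conv_lhs => rw [← hK, add_assoc, mul_comm, Nat.mul_add_mod, Nat.mod_eq_of_lt hlast]
      have key : ∀ i m, (m ∉ A (K / D) (K % D + 1) → i ∉ A (K / D) (K % D)) →
          barrierLevel D A K i ≤ barrierLevel D A (K + 1) m := by
        intro i m him
        by_cases hm : m ∈ A (K / D) (K % D + 1)
        · refine (hle i).trans ?_
          rw [barrierLevel, h1, h2, if_pos hm]
        · rw [barrierLevel, barrierLevel, h1, h2, if_neg hm, if_neg (him hm)]
      refine hstep.levelLE ih (fun m => key m m fun hm hm' => hm (hA.mono _ _ hlast hm'))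
        fun i m him => key i m fun hm hm' => hm (hA.adj _ _ hlast i hm' m ?_)
      rwa [hK]
    -- When a period ends, all nodes are within its upper level, which is the base level of the next
    -- period.
    · have h1 : (K + 1) / D = K / D + 1 := by
        have : K + 1 = D * (K / D + 1) := by
          rw [mul_comm, add_mul, one_mul]
          omega
        rw [this, Nat.mul_div_cancel_left _ hD]
      have key : ∀ i m, barrierLevel D A K i ≤ barrierLevel D A (K + 1) m := fun i m => by
        refine (hle i).trans ?_
        rw [barrierLevel, h1]
        omega
      exact hstep.levelLE ih (fun m => key m m) fun i m _ => key i m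

lemma Memory.LevelLE.span_y {k : ℕ} (h : S.LevelLE fun _ => k) :
    Submodule.span ℝ (⋃ m, S.y m) ≤ levelY n k :=
  Submodule.span_le.2 (Set.iUnion_subset fun m => (h m).2)

end

/-! ### Weighted Laplacians and their condition numbers. -/

/-- The graph of the pairs to which `w` gives a nonzero weight in either order. -/
def weightGraph {V : Type*} (w : V → V → ℝ) : SimpleGraph V where
  Adj i j := i ≠ j ∧ (w i j ≠ 0 ∨ w j i ≠ 0)
  symm := ⟨fun _ _ h => ⟨h.1.symm, h.2.symm⟩⟩
  loopless := ⟨fun _ h => h.1 rfl⟩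

/-- The Laplacian matrix of the weights `w i j + w j i`. -/
def weightLaplacian {V : Type*} [Fintype V] [DecidableEq V] (w : V → V → ℝ) : Matrix V V ℝ :=
  Matrix.diagonal (fun i => ∑ j, (w i j + w j i)) - Matrix.of fun i j => w i j + w j i

section
variable {V : Type*} [Fintype V] [DecidableEq V] (w : V → V → ℝ) (x : V → ℝ)

lemma weightLaplacian_mulVec (i : V) :
    (weightLaplacian w).mulVec x i = ∑ j, (w i j + w j i) * (x i - x j) := by
  rw [weightLaplacian, Matrix.sub_mulVec, Pi.sub_apply, Matrix.mulVec_diagonal, Finset.sum_mul]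
  simp only [Matrix.mulVec, dotProduct, Matrix.of_apply, mul_sub, Finset.sum_sub_distrib]

/-- Thanks to the symmetrisation in the Laplacian, an edge may be listed in one orientation only and
is then counted once. -/
lemma sum_mul_weightLaplacian_mulVec :
    ∑ i, x i * (weightLaplacian w).mulVec x i = ∑ i, ∑ j, w i j * (x i - x j) ^ 2 := by
  have h : ∑ i, ∑ j, x i * (w j i * (x i - x j)) = ∑ i, ∑ j, x j * (w i j * (x j - x i)) :=
    Finset.sum_comm
  simp only [weightLaplacian_mulVec, Finset.mul_sum, add_mul, mul_add, Finset.sum_add_distrib, h]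
  simp only [← Finset.sum_add_distrib]
  refine Finset.sum_congr rfl fun i _ => Finset.sum_congr rfl fun j _ => ?_
  ring

lemma sum_weightLaplacian_mulVec : ∑ i, (weightLaplacian w).mulVec x i = 0 := by
  have h : ∑ i, ∑ j, w j i * (x i - x j) = ∑ i, ∑ j, w i j * (x j - x i) := Finset.sum_comm
  simp only [weightLaplacian_mulVec, add_mul, Finset.sum_add_distrib, h]
  simp only [← Finset.sum_add_distrib]
  refine Finset.sum_eq_zero fun i _ => Finset.sum_eq_zero fun j _ => ?_
  ring

end

section
variable {M : ℕ} {w : Fin M → Fin M → ℝ} {a b : ℝ}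

lemma isGossip_weightLaplacian (hw : ∀ i j, 0 ≤ w i j) (ha : 0 < a)
    (hlow : ∀ x : Fin M → ℝ, ∑ i, x i = 0 →
      a * ∑ i, x i ^ 2 ≤ ∑ i, ∑ j, w i j * (x i - x j) ^ 2) :
    IsGossip (weightGraph w) (weightLaplacian w) where
  posSemidef := by
    refine Matrix.PosSemidef.of_dotProduct_mulVec_nonneg ?_ fun x => ?_
    · ext i j
      by_cases h : i = j
      · simp [h]
      · simp [weightLaplacian, Matrix.diagonal_apply_ne _ h, Matrix.diagonal_apply_ne' _ h,
          add_comm]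
    · simp only [star_trivial, dotProduct]
      rw [sum_mul_weightLaplacian_mulVec]
      exact Finset.sum_nonneg fun i _ => Finset.sum_nonneg fun j _ =>
        mul_nonneg (hw i j) (sq_nonneg _)
  support i j hij h := by
    have h' : ¬ (w i j ≠ 0 ∨ w j i ≠ 0) := fun hh => h ⟨hij, hh⟩
    push Not at h'
    simp [weightLaplacian, Matrix.diagonal_apply_ne _ hij, h'.1, h'.2]
  ker := by
    ext x
    rw [LinearMap.mem_ker, Matrix.toLin'_apply, Submodule.mem_span_singleton]
    constructor
    · intro hx
      rcases Nat.eq_zero_or_pos M with rfl | hM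
      · exact ⟨0, Subsingleton.elim _ _⟩
      -- Centring by the mean makes `hlow` applicable without changing the quadratic form, which
      -- vanishes on the kernel.
      · set t := (∑ i, x i) / M
        have hM' : (M : ℝ) ≠ 0 := by positivity
        have h0 : ∑ i, (x i - t) = 0 := by
          simp only [Finset.sum_sub_distrib, Finset.sum_const, Finset.card_univ, Fintype.card_fin,
            nsmul_eq_mul, t]
          field_simp
          ring
        have h1 := hlow (fun i => x i - t) h0
        have h2 := sum_mul_weightLaplacian_mulVec w x
        simp only [hx, Pi.zero_apply, mul_zero, Finset.sum_const_zero] at h2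
        simp only [sub_sub_sub_cancel_right, ← h2] at h1
        have h3 : 0 ≤ ∑ i, (x i - t) ^ 2 := Finset.sum_nonneg fun i _ => sq_nonneg _
        have h4 : ∑ i, (x i - t) ^ 2 = 0 := by nlinarith
        rw [Finset.sum_eq_zero_iff_of_nonneg fun i _ => sq_nonneg _] at h4
        refine ⟨t, funext fun i => ?_⟩
        have := pow_eq_zero_iff two_ne_zero |>.1 (h4 i (Finset.mem_univ i))
        simp only [Pi.smul_apply, smul_eq_mul, mul_one]
        linarith
    · rintro ⟨t, rfl⟩
      ext i
      simp [weightLaplacian_mulVec]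

lemma mem_eigenvalueSet_weightLaplacian {v : Fin M → ℝ} (hv : v ≠ 0)
    (h : ∀ i, ∑ j, (w i j + w j i) * (v i - v j) = a * v i) :
    a ∈ eigenvalueSet (weightLaplacian w) := by
  refine Module.End.hasEigenvalue_of_hasEigenvector (x := v)
    ⟨Module.End.mem_eigenspace_iff.2 (funext fun i => ?_), hv⟩
  rw [Matrix.toLin'_apply, weightLaplacian_mulVec, h]
  rfl

/-- An eigenvector of positive eigenvalue has coordinate sum zero, because the entries of a
Laplacian image sum to zero; so `hlow` bounds its Rayleigh quotient. -/
lemma condNumber_weightLaplacian (ha : 0 < a)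
    (hlow : ∀ x : Fin M → ℝ, ∑ i, x i = 0 →
      a * ∑ i, x i ^ 2 ≤ ∑ i, ∑ j, w i j * (x i - x j) ^ 2)
    (hup : ∀ x : Fin M → ℝ, ∑ i, ∑ j, w i j * (x i - x j) ^ 2 ≤ b * ∑ i, x i ^ 2)
    (hae : a ∈ eigenvalueSet (weightLaplacian w))
    (hbe : b ∈ eigenvalueSet (weightLaplacian w)) :
    condNumber (weightLaplacian w) = b / a := by
  have key : ∀ t ∈ eigenvalueSet (weightLaplacian w), ∃ x : Fin M → ℝ, 0 < ∑ i, x i ^ 2 ∧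
      ∑ i, ∑ j, w i j * (x i - x j) ^ 2 = t * ∑ i, x i ^ 2 ∧ t * ∑ i, x i = 0 := by
    intro t ht
    obtain ⟨x, hx, hx0⟩ := Module.End.HasEigenvalue.exists_hasEigenvector ht
    have hx : ∀ i, (weightLaplacian w).mulVec x i = t * x i := fun i =>
      congrFun (Module.End.mem_eigenspace_iff.1 hx) i
    refine ⟨x, ?_, ?_, ?_⟩
    · obtain ⟨i, hi⟩ := Function.ne_iff.1 hx0
      exact Finset.sum_pos' (fun i _ => sq_nonneg _)
        ⟨i, Finset.mem_univ i, by have : x i ≠ 0 := hi; positivity⟩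
    · rw [← sum_mul_weightLaplacian_mulVec, Finset.mul_sum]
      refine Finset.sum_congr rfl fun i _ => ?_
      rw [hx]
      ring
    · rw [Finset.mul_sum, ← sum_weightLaplacian_mulVec w x]
      exact Finset.sum_congr rfl fun i _ => (hx i).symm
  have h1 : IsGreatest (eigenvalueSet (weightLaplacian w)) b := by
    refine ⟨hbe, fun t ht => ?_⟩
    obtain ⟨x, hx, hq, -⟩ := key t ht
    exact le_of_mul_le_mul_right (hq ▸ hup x) hx
  have h2 : IsLeast {t | t ∈ eigenvalueSet (weightLaplacian w) ∧ 0 < t} a := by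
    refine ⟨⟨hae, ha⟩, fun t ht => ?_⟩
    obtain ⟨x, hx, hq, h0⟩ := key t ht.1
    exact le_of_mul_le_mul_right (hq ▸ hlow x ((mul_eq_zero.1 h0).resolve_left ht.2.ne')) hx
  rw [condNumber, h1.csSup_eq, h2.csInf_eq]

/-- A constant network on three nodes for small condition numbers. -/
lemma exists_slowNetwork_triangle {χ : ℝ} (hχ : 1 ≤ χ) :
    ∃ (G : ℕ → SimpleGraph (Fin 3)) (W : ℕ → Matrix (Fin 3) (Fin 3) ℝ)
      (A : ℕ → ℕ → Set (Fin 3)), IsSlowNetwork G W χ ∧ IsBarrier G 1 0 1 A := by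
  -- The triangle has eigenvalues 0, 3 and 1 + 2s; this choice makes the last one 3χ.
  set s := (3 * χ - 1) / 2 with hs
  have hs1 : 1 ≤ s := by rw [hs]; linarith
  let w : Fin 3 → Fin 3 → ℝ := ![![0, s, 1], ![0, 0, 1], ![0, 0, 0]]
  have hq : ∀ x : Fin 3 → ℝ, ∑ i, ∑ j, w i j * (x i - x j) ^ 2
      = s * (x 0 - x 1) ^ 2 + (x 0 - x 2) ^ 2 + (x 1 - x 2) ^ 2 := fun x => by
    simp [Fin.sum_univ_three, w]
  have hlow : ∀ x : Fin 3 → ℝ, ∑ i, x i = 0 →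
      3 * ∑ i, x i ^ 2 ≤ ∑ i, ∑ j, w i j * (x i - x j) ^ 2 := fun x hx => by
    rw [hq]
    rw [Fin.sum_univ_three] at hx ⊢
    obtain hx : x 2 = -x 0 - x 1 := by linarith
    rw [hx]
    nlinarith [mul_nonneg (sub_nonneg.2 hs1) (sq_nonneg (x 0 - x 1))]
  have hup : ∀ x : Fin 3 → ℝ, ∑ i, ∑ j, w i j * (x i - x j) ^ 2 ≤ (3 * χ) * ∑ i, x i ^ 2 := by
    intro x
    rw [hq, Fin.sum_univ_three, show 3 * χ = 1 + 2 * s by rw [hs]; ring]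
    nlinarith [mul_nonneg (sub_nonneg.2 hs1) (sq_nonneg (x 0 + x 1)),
      mul_nonneg (sub_nonneg.2 hs1) (sq_nonneg (x 2)), sq_nonneg (x 0 + x 1 + x 2)]
  have hae : 3 ∈ eigenvalueSet (weightLaplacian w) := by
    refine mem_eigenvalueSet_weightLaplacian (v := ![1, 1, -2]) (fun h => ?_) fun i => ?_
    · simpa using congrFun h 0
    · fin_cases i <;> simp [Fin.sum_univ_three, w] <;> norm_num
  have hbe : 3 * χ ∈ eigenvalueSet (weightLaplacian w) := by
    refine mem_eigenvalueSet_weightLaplacian (v := ![1, -1, 0]) (fun h => ?_) fun i => ?_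
    · simpa using congrFun h 0
    · fin_cases i <;> simp [Fin.sum_univ_three, w, hs] <;> ring
  have hc := condNumber_weightLaplacian three_pos hlow hup hae hbe
  have hg : IsGossip (weightGraph w) (weightLaplacian w) := by
    refine isGossip_weightLaplacian (fun i j => ?_) three_pos hlow
    fin_cases i <;> fin_cases j <;> simp [w]
    linarith
  refine ⟨fun _ => weightGraph w, fun _ => weightLaplacian w,
    fun j _ => {if Even j then 0 else 1}, ⟨fun k => by simp, fun _ => hg, ?_⟩, ?_⟩
  · have : (fun _ : ℕ => condNumber (weightLaplacian w)) = fun _ => χ := by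
      funext _
      rw [hc]
      ring
    rw [this, Set.range_const]
    exact isLUB_singleton
  · refine ⟨fun j i _ => rfl, fun j i _ => ?_, fun j i h => by omega, fun j i h => by omega⟩
    by_cases hj : Even j <;> simp [hj]

end

section
variable {M : ℕ} {V : Type*} [Fintype V] (e : Fin M ≃ V) (w : V → V → ℝ)

lemma sum_sum_comp_equiv (F : V → V → ℝ) : ∑ i, ∑ j, F (e i) (e j) = ∑ i, ∑ j, F i j := by
  rw [← e.sum_comp (fun i => ∑ j, F i j)]
  exact Finset.sum_congr rfl fun i _ => e.sum_comp (F (e i))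

/-- A network on the nodes `V`, given by weights. -/
lemma isSlowNetwork_of_weights {w : ℕ → V → V → ℝ} {a χ : ℝ} (hw : ∀ k i j, 0 ≤ w k i j)
    (ha : 0 < a)
    (hlow : ∀ k (x : V → ℝ), ∑ i, x i = 0 →
      a * ∑ i, x i ^ 2 ≤ ∑ i, ∑ j, w k i j * (x i - x j) ^ 2)
    (hup : ∀ k (x : V → ℝ), ∑ i, ∑ j, w k i j * (x i - x j) ^ 2 ≤ χ * a * ∑ i, x i ^ 2)
    (hae : ∀ k, ∃ v : V → ℝ, v ≠ 0 ∧ ∀ i, ∑ j, (w k i j + w k j i) * (v i - v j) = a * v i)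
    (hbe : ∀ k, ∃ v : V → ℝ, v ≠ 0 ∧ ∀ i, ∑ j, (w k i j + w k j i) * (v i - v j) = χ * a * v i)
    (hG : SlowlyVarying fun k => weightGraph fun i j => w k (e i) (e j)) :
    IsSlowNetwork (fun k => weightGraph fun i j => w k (e i) (e j))
      (fun k => weightLaplacian fun i j => w k (e i) (e j)) χ := by
  have hsum : ∀ x : Fin M → ℝ, ∑ i, x i = ∑ i, x (e.symm i) := fun x =>
    (e.symm.sum_comp x).symm
  have hquad : ∀ k (x : Fin M → ℝ), ∑ i, ∑ j, w k (e i) (e j) * (x i - x j) ^ 2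
      = ∑ i, ∑ j, w k i j * (x (e.symm i) - x (e.symm j)) ^ 2 := fun k x => by
    rw [← sum_sum_comp_equiv e fun i j => w k i j * (x (e.symm i) - x (e.symm j)) ^ 2]
    simp
  have heig : ∀ k b, (∃ v : V → ℝ, v ≠ 0 ∧
      ∀ i, ∑ j, (w k i j + w k j i) * (v i - v j) = b * v i) →
      b ∈ eigenvalueSet (weightLaplacian fun i j => w k (e i) (e j)) := by
    rintro k b ⟨v, hv, h⟩
    refine mem_eigenvalueSet_weightLaplacian (v := v ∘ e) (fun h0 => hv ?_) fun i => ?_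
    · ext i
      simpa using congrFun h0 (e.symm i)
    · rw [Function.comp_apply, ← h (e i)]
      exact e.sum_comp fun j => (w k (e i) j + w k j (e i)) * (v (e i) - v j)
  have hlow' : ∀ k (x : Fin M → ℝ), ∑ i, x i = 0 →
      a * ∑ i, x i ^ 2 ≤ ∑ i, ∑ j, w k (e i) (e j) * (x i - x j) ^ 2 := fun k x hx => by
    rw [hquad, hsum fun i => x i ^ 2]
    exact hlow k (fun i => x (e.symm i)) (by rw [← hsum, hx])
  refine ⟨hG, fun k => isGossip_weightLaplacian (fun i j => hw k _ _) ha (hlow' k), ?_⟩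
  have : (fun k => condNumber (weightLaplacian fun i j => w k (e i) (e j))) = fun _ => χ := by
    funext k
    rw [condNumber_weightLaplacian ha (hlow' k) (fun x => ?_) (heig k a (hae k))
      (heig k _ (hbe k)), mul_div_cancel_right₀ _ ha.ne']
    rw [hquad, hsum fun i => x i ^ 2]
    exact hup k _
  rw [this, Set.range_const]
  exact isLUB_singleton

end

/-! ### The network of two hubs and D movers. -/

/-- The weights of the edges between the hubs `0`, `1` and the movers: the movers before the
`p`-th are leaves at hub `0`, those after it are leaves at hub `1`, and the `p`-th one is
joined to both hubs. -/
def hubWeight (D p : ℕ) (a : Fin 5) (t : Fin D) : ℝ :=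
  if a = 0 then (if (t : ℕ) < p then 1 else if (t : ℕ) = p then D else 0)
  else if a = 1 then (if p < t then 1 else if (t : ℕ) = p then D else 0)
  else 0

/-- The weights among the hubs and the three pendant nodes `2`, `3`, `4`. -/
def pendantWeight (s : ℝ) (a b : Fin 5) : ℝ :=
  if a = 0 ∧ 2 ≤ b then 1 / 8 else if a = 2 ∧ b = 3 then s else 0

/-- The weights of the network when the `p`-th mover is joined to both hubs. -/
def moverWeight (D : ℕ) (s : ℝ) (p : ℕ) : Fin 5 ⊕ Fin D → Fin 5 ⊕ Fin D → ℝ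
  | .inl a, .inl b => pendantWeight s a b
  | .inl a, .inr t => hubWeight D p a t
  | .inr _, _ => 0

section
variable {D p : ℕ} {s : ℝ}

lemma hubWeight_nonneg (a : Fin 5) (t : Fin D) : 0 ≤ hubWeight D p a t := by
  unfold hubWeight
  split_ifs <;> positivity

lemma moverWeight_nonneg (hs : 0 ≤ s) (i j : Fin 5 ⊕ Fin D) : 0 ≤ moverWeight D s p i j := by
  rcases i with a | t <;> rcases j with b | u
  · simp only [moverWeight, pendantWeight]
    split_ifs <;> positivity
  · exact hubWeight_nonneg a u
  · exact le_rfl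
  · exact le_rfl

lemma moverWeight_quadratic (x : Fin 5 ⊕ Fin D → ℝ) :
    ∑ i, ∑ j, moverWeight D s p i j * (x i - x j) ^ 2 =
      ∑ t, (hubWeight D p 0 t * (x (.inl 0) - x (.inr t)) ^ 2
        + hubWeight D p 1 t * (x (.inl 1) - x (.inr t)) ^ 2)
      + 1 / 8 * ((x (.inl 0) - x (.inl 2)) ^ 2 + (x (.inl 0) - x (.inl 3)) ^ 2
        + (x (.inl 0) - x (.inl 4)) ^ 2) + s * (x (.inl 2) - x (.inl 3)) ^ 2 := by
  have h : ∀ a : Fin 5, a ≠ 0 → a ≠ 1 → ∀ t : Fin D, hubWeight D p a t = 0 := fun a h0 h1 t => by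
    simp [hubWeight, h0, h1]
  simp only [Fintype.sum_sum_type, moverWeight, Fin.sum_univ_five, zero_mul,
    Finset.sum_const_zero, add_zero, h 2 (by decide) (by decide), h 3 (by decide) (by decide),
    h 4 (by decide) (by decide), Finset.sum_add_distrib]
  simp [pendantWeight]
  ring

/-- With hub 0 grounded, let E be the energy of the hub–mover edges and r the value at hub 1. The
two bridge edges in series give D r² ≤ 2E, so even D movers sitting near r are affordable: the
movers have square sum at most 2E + 2D r² ≤ 6E. Adding r² ≤ 2E gives 8E, hence the constant 1/8. -/
lemma moverWeight_quadratic_ge_of_zero (hD : 0 < D) (hp : p < D) (hs : 0 ≤ s)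
    {x : Fin 5 ⊕ Fin D → ℝ} (hx : x (.inl 0) = 0) :
    1 / 8 * ∑ i, x i ^ 2 ≤ ∑ i, ∑ j, moverWeight D s p i j * (x i - x j) ^ 2 := by
  rw [moverWeight_quadratic, Fintype.sum_sum_type, Fin.sum_univ_five, hx]
  simp only [zero_sub, neg_sq]
  set r := x (.inl 1)
  set F : Fin D → ℝ := fun t =>
    hubWeight D p 0 t * x (.inr t) ^ 2 + hubWeight D p 1 t * (r - x (.inr t)) ^ 2
  have hD1 : (1 : ℝ) ≤ D := by exact_mod_cast hD
  have hF0 : ∀ t, 0 ≤ F t := fun t => add_nonneg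
    (mul_nonneg (hubWeight_nonneg _ _) (sq_nonneg _))
    (mul_nonneg (hubWeight_nonneg _ _) (sq_nonneg _))
  have hF1 : ∀ t, x (.inr t) ^ 2 ≤ 2 * F t + 2 * r ^ 2 := fun t => by
    rcases lt_trichotomy (t : ℕ) p with h | h | h
    · have : F t = x (.inr t) ^ 2 := by simp [F, hubWeight, h, h.not_gt, h.ne]
      nlinarith [sq_nonneg r, sq_nonneg (x (.inr t))]
    · have : F t = D * x (.inr t) ^ 2 + D * (r - x (.inr t)) ^ 2 := by simp [F, hubWeight, h]
      nlinarith [sq_nonneg r, sq_nonneg (x (.inr t)),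
        mul_nonneg (sub_nonneg.2 hD1) (sq_nonneg (x (.inr t))),
        mul_nonneg (sub_nonneg.2 hD1) (sq_nonneg (r - x (.inr t))),
        sq_nonneg (r - x (.inr t))]
    · have : F t = (r - x (.inr t)) ^ 2 := by simp [F, hubWeight, h, h.not_gt, h.ne']
      nlinarith [sq_nonneg (2 * r - x (.inr t))]
  have hF2 : D * r ^ 2 ≤ 2 * ∑ t, F t := by
    have h1 : F ⟨p, hp⟩ ≤ ∑ t, F t :=
      Finset.single_le_sum (fun t _ => hF0 t) (Finset.mem_univ _)
    have h2 : F ⟨p, hp⟩ = D * x (.inr ⟨p, hp⟩) ^ 2 + D * (r - x (.inr ⟨p, hp⟩)) ^ 2 := by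
      simp [F, hubWeight]
    have h3 : 0 ≤ D * (r - 2 * x (.inr ⟨p, hp⟩)) ^ 2 := by positivity
    nlinarith
  have hF3 : ∑ t, x (.inr t) ^ 2 ≤ 2 * ∑ t, F t + 2 * (D * r ^ 2) := by
    refine (Finset.sum_le_sum fun t _ => hF1 t).trans_eq ?_
    rw [Finset.sum_add_distrib, ← Finset.mul_sum, Finset.sum_const, Finset.card_univ,
      Fintype.card_fin, nsmul_eq_mul]
    ring
  have h4 : r ^ 2 ≤ D * r ^ 2 := le_mul_of_one_le_left (sq_nonneg r) hD1
  have h5 : 0 ≤ s * (x (.inl 2) - x (.inl 3)) ^ 2 := by positivity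
  change _ ≤ ∑ t, F t + _ + _
  linarith

/-- Grounding hub 0 leaves the energy unchanged and cannot decrease the square sum of a mean-zero
vector. -/
lemma moverWeight_quadratic_ge (hD : 0 < D) (hp : p < D) (hs : 0 ≤ s)
    {x : Fin 5 ⊕ Fin D → ℝ} (hx : ∑ i, x i = 0) :
    1 / 8 * ∑ i, x i ^ 2 ≤ ∑ i, ∑ j, moverWeight D s p i j * (x i - x j) ^ 2 := by
  have h := moverWeight_quadratic_ge_of_zero (x := fun i => x i - x (.inl 0)) hD hp hs
    (sub_self _)
  simp only [sub_sub_sub_cancel_right] at h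
  refine le_trans ?_ h
  gcongr 1 / 8 * ?_
  have : ∑ i, (x i - x (.inl 0)) ^ 2 = ∑ i, x i ^ 2 - 2 * x (.inl 0) * ∑ i, x i
      + ∑ _i : Fin 5 ⊕ Fin D, x (.inl 0) ^ 2 := by
    rw [Finset.mul_sum, ← Finset.sum_sub_distrib, ← Finset.sum_add_distrib]
    exact Finset.sum_congr rfl fun i _ => by ring
  rw [this, hx]
  have : 0 ≤ ∑ _i : Fin 5 ⊕ Fin D, x (.inl 0) ^ 2 := by positivity
  linarith

lemma sum_hubWeight_le (a : Fin 5) : ∑ t, hubWeight D p a t ≤ 2 * D := by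
  have h : ∀ t, hubWeight D p a t ≤ 1 + if (t : ℕ) = p then (D : ℝ) else 0 := fun t => by
    unfold hubWeight
    have : (0 : ℝ) ≤ D := by positivity
    split_ifs <;> linarith
  refine (Finset.sum_le_sum fun t _ => h t).trans ?_
  rw [Finset.sum_add_distrib]
  have : ∑ t : Fin D, (if (t : ℕ) = p then (D : ℝ) else 0) ≤ D := by
    by_cases hp : p < D
    · have : ∀ t : Fin D, (t : ℕ) = p ↔ t = ⟨p, hp⟩ := fun t => by simp [Fin.ext_iff]
      simp [this]
    · have : ∀ t : Fin D, (t : ℕ) ≠ p := fun t => by omega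
      simp [this]
  simp only [Finset.sum_const, Finset.card_univ, Fintype.card_fin, nsmul_eq_mul, mul_one]
  linarith

/-- Hubs and movers have weighted degree at most 2D towards each other, costing 4D per squared
coordinate; the fifth D absorbs the pendant edges at hub 0. -/
lemma moverWeight_quadratic_le (hD : 0 < D) (hs : 5 * D ≤ 1 / 8 + 2 * s)
    (x : Fin 5 ⊕ Fin D → ℝ) :
    ∑ i, ∑ j, moverWeight D s p i j * (x i - x j) ^ 2 ≤ (1 / 8 + 2 * s) * ∑ i, x i ^ 2 := by
  rw [moverWeight_quadratic, Fintype.sum_sum_type, Fin.sum_univ_five]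
  have hD1 : (1 : ℝ) ≤ D := by exact_mod_cast hD
  have h1 : ∀ t, hubWeight D p 0 t + hubWeight D p 1 t ≤ 2 * D := fun t => by
    rcases lt_trichotomy (t : ℕ) p with h | h | h
    · have : hubWeight D p 0 t + hubWeight D p 1 t = 1 := by simp [hubWeight, h, h.not_gt, h.ne]
      linarith
    · have : hubWeight D p 0 t + hubWeight D p 1 t = 2 * D := by simp [hubWeight, h, two_mul]
      linarith
    · have : hubWeight D p 0 t + hubWeight D p 1 t = 1 := by simp [hubWeight, h, h.not_gt, h.ne']
      linarith
  have h2 : ∑ t, (hubWeight D p 0 t * (x (.inl 0) - x (.inr t)) ^ 2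
        + hubWeight D p 1 t * (x (.inl 1) - x (.inr t)) ^ 2)
      ≤ ∑ t, (hubWeight D p 0 t * (2 * x (.inl 0) ^ 2) + hubWeight D p 1 t * (2 * x (.inl 1) ^ 2)
        + 4 * D * x (.inr t) ^ 2) := by
    refine Finset.sum_le_sum fun t _ => ?_
    have e0 := mul_le_mul_of_nonneg_left (a := hubWeight D p 0 t)
      (show (x (.inl 0) - x (.inr t)) ^ 2 ≤ 2 * x (.inl 0) ^ 2 + 2 * x (.inr t) ^ 2 by
        nlinarith [sq_nonneg (x (.inl 0) + x (.inr t))]) (hubWeight_nonneg _ _)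
    have e1 := mul_le_mul_of_nonneg_left (a := hubWeight D p 1 t)
      (show (x (.inl 1) - x (.inr t)) ^ 2 ≤ 2 * x (.inl 1) ^ 2 + 2 * x (.inr t) ^ 2 by
        nlinarith [sq_nonneg (x (.inl 1) + x (.inr t))]) (hubWeight_nonneg _ _)
    have e2 := mul_le_mul_of_nonneg_right (h1 t) (sq_nonneg (x (.inr t)))
    linarith
  have hsum : ∑ t, (hubWeight D p 0 t * (2 * x (.inl 0) ^ 2)
        + hubWeight D p 1 t * (2 * x (.inl 1) ^ 2) + 4 * D * x (.inr t) ^ 2)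
      = (∑ t, hubWeight D p 0 t) * (2 * x (.inl 0) ^ 2)
        + (∑ t, hubWeight D p 1 t) * (2 * x (.inl 1) ^ 2) + 4 * D * ∑ t, x (.inr t) ^ 2 := by
    simp only [Finset.sum_add_distrib, Finset.sum_mul, Finset.mul_sum]
  rw [hsum] at h2
  have h3 := mul_le_mul_of_nonneg_right (sum_hubWeight_le (D := D) (p := p) 0)
    (show 0 ≤ 2 * x (.inl 0) ^ 2 by positivity)
  have h4 := mul_le_mul_of_nonneg_right (sum_hubWeight_le (D := D) (p := p) 1)
    (show 0 ≤ 2 * x (.inl 1) ^ 2 by positivity)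
  have hΛ : 0 ≤ 1 / 8 + 2 * s - 5 * D := by linarith
  have h5 : 0 ≤ (1 / 8 + 2 * s - 5 * D) * ∑ t, x (.inr t) ^ 2 := by positivity
  have h6 : 0 ≤ (D : ℝ) * ∑ t, x (.inr t) ^ 2 := by positivity
  have h7 := mul_nonneg hΛ (sq_nonneg (x (.inl 0)))
  have h8 := mul_nonneg hΛ (sq_nonneg (x (.inl 1)))
  have h9 := mul_nonneg hΛ (sq_nonneg (x (.inl 4)))
  have h10 := mul_nonneg (sub_nonneg.2 hD1) (sq_nonneg (x (.inl 0)))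
  have h11 := mul_nonneg (sub_nonneg.2 hD1) (sq_nonneg (x (.inl 1)))
  have h12 := mul_nonneg (sub_nonneg.2 hD1) (sq_nonneg (x (.inl 4)))
  have h13 : 1 / 8 * ((x (.inl 0) - x (.inl 2)) ^ 2 + (x (.inl 0) - x (.inl 3)) ^ 2)
      + s * (x (.inl 2) - x (.inl 3)) ^ 2
      ≤ (1 / 8 + 2 * s) * (x (.inl 2) ^ 2 + x (.inl 3) ^ 2) + 3 / 8 * x (.inl 0) ^ 2 := by
    have hs1 : 0 ≤ s - 1 := by linarith
    nlinarith [mul_nonneg hs1 (sq_nonneg (x (.inl 2) + x (.inl 3))),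
      sq_nonneg (x (.inl 2) + x (.inl 3) + x (.inl 0)), sq_nonneg (x (.inl 0)),
      sq_nonneg (x (.inl 2) + x (.inl 3))]
  have h14 := sq_nonneg (x (.inl 0) + x (.inl 4))
  nlinarith

lemma moverWeight_eigen_small (i : Fin 5 ⊕ Fin D) :
    ∑ j, (moverWeight D s p i j + moverWeight D s p j i)
      * (Sum.elim ![0, 0, 1, 1, -2] (fun _ => 0) i - Sum.elim ![0, 0, 1, 1, -2] (fun _ => 0) j)
      = 1 / 8 * Sum.elim ![0, 0, 1, 1, -2] (fun _ => (0 : ℝ)) i := by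
  rw [Fintype.sum_sum_type, Fin.sum_univ_five]
  rcases i with a | t
  · fin_cases a <;> simp [moverWeight, pendantWeight, hubWeight]
    all_goals norm_num
  · simp [moverWeight, hubWeight]

lemma moverWeight_eigen_large (i : Fin 5 ⊕ Fin D) :
    ∑ j, (moverWeight D s p i j + moverWeight D s p j i)
      * (Sum.elim ![0, 0, 1, -1, 0] (fun _ => 0) i - Sum.elim ![0, 0, 1, -1, 0] (fun _ => 0) j)
      = (1 / 8 + 2 * s) * Sum.elim ![0, 0, 1, -1, 0] (fun _ => (0 : ℝ)) i := by
  rw [Fintype.sum_sum_type, Fin.sum_univ_five]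
  rcases i with a | t
  · fin_cases a <;> simp [moverWeight, pendantWeight, hubWeight]
    all_goals ring
  · simp [moverWeight, hubWeight]


lemma moverWeight_adj_inl_inl {a b : Fin 5}
    (h : (weightGraph (moverWeight D s p)).Adj (.inl a) (.inl b)) : a ≠ 1 ∧ b ≠ 1 := by
  obtain ⟨-, h⟩ := h
  simp only [moverWeight, pendantWeight] at h
  constructor <;> rintro rfl <;> simp at h

lemma moverWeight_adj_inl_inr {a : Fin 5} {t : Fin D} :
    (weightGraph (moverWeight D s p)).Adj (.inl a) (.inr t) ↔
      a = 0 ∧ (t : ℕ) ≤ p ∨ a = 1 ∧ p ≤ t := by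
  have hD : (D : ℝ) ≠ 0 := by
    have := t.pos
    positivity
  simp only [weightGraph, moverWeight, hubWeight, ne_eq, reduceCtorEq, not_false_eq_true,
    true_and, not_true_eq_false, or_false]
  by_cases h0 : a = 0
  · rcases lt_trichotomy (t : ℕ) p with h | h | h
    · simp [h0, h, h.le]
    · simp [h0, h, hD]
    · simp [h0, h.not_gt, h.ne', h]
  · by_cases h1 : a = 1
    · rcases lt_trichotomy (t : ℕ) p with h | h | h
      · simp [h1, h.not_gt, h.ne, h]
      · simp [h1, h, hD]
      · simp [h1, h, h.le]
    · simp [h0, h1]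

lemma not_moverWeight_adj_inr_inr {t u : Fin D} :
    ¬ (weightGraph (moverWeight D s p)).Adj (.inr t) (.inr u) := by
  simp [weightGraph, moverWeight]

/-- The old bridge loses hub 1 and the next mover gains hub 0; nothing else changes. -/
lemma edgeSet_symmDiff_moverWeight (hp : p + 1 < D) :
    symmDiff (weightGraph (moverWeight D s p)).edgeSet
      (weightGraph (moverWeight D s (p + 1))).edgeSet ⊆
      {s(.inl 1, .inr ⟨p, by omega⟩), s(.inl 0, .inr ⟨p + 1, hp⟩)} := by
  have key : ∀ (a : Fin 5) (t : Fin D), ¬ ((weightGraph (moverWeight D s p)).Adj (.inl a) (.inr t)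
      ↔ (weightGraph (moverWeight D s (p + 1))).Adj (.inl a) (.inr t)) →
      s(.inl a, .inr t) ∈ ({s(.inl 1, .inr ⟨p, by omega⟩), s(.inl 0, .inr ⟨p + 1, hp⟩)} :
        Set (Sym2 (Fin 5 ⊕ Fin D))) := by
    intro a t h
    rw [moverWeight_adj_inl_inr, moverWeight_adj_inl_inr] at h
    by_cases h0 : a = 0
    · subst h0
      right
      have ht : (t : ℕ) = p + 1 := by
        simp at h
        omega
      rw [show t = ⟨p + 1, hp⟩ from Fin.ext ht]
      rfl
    · by_cases h1 : a = 1
      · subst h1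
        left
        have ht : (t : ℕ) = p := by
          simp at h
          omega
        rw [show t = ⟨p, by omega⟩ from Fin.ext ht]
      · simp [h0, h1] at h
  intro q
  induction q using Sym2.ind with
  | h i j =>
    intro h
    have h' : ¬ ((weightGraph (moverWeight D s p)).Adj i j
        ↔ (weightGraph (moverWeight D s (p + 1))).Adj i j) := by
      rw [Set.mem_symmDiff] at h
      simp only [SimpleGraph.mem_edgeSet] at h
      tauto
    rcases i with a | t <;> rcases j with b | u
    · exact absurd Iff.rfl h'
    · exact key a u h'
    · have hswap : s((Sum.inr t : Fin 5 ⊕ Fin D), .inl b) = s(.inl b, .inr t) := Sym2.eq_swap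
      rw [hswap]
      refine key b t ?_
      rwa [SimpleGraph.adj_comm, SimpleGraph.adj_comm _ (Sum.inl b)]
    · exact absurd (iff_of_false not_moverWeight_adj_inr_inr not_moverWeight_adj_inr_inr) h'

lemma ncard_symmDiff_moverWeight_le {M : ℕ} (e : Fin M ≃ Fin 5 ⊕ Fin D) (hp : p + 1 < D) :
    (symmDiff (weightGraph fun i j => moverWeight D s p (e i) (e j)).edgeSet
      (weightGraph fun i j => moverWeight D s (p + 1) (e i) (e j)).edgeSet).ncard ≤ 2 := by
  have hadj : ∀ p i j, (weightGraph fun i j => moverWeight D s p (e i) (e j)).Adj i j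
      ↔ (weightGraph (moverWeight D s p)).Adj (e i) (e j) := fun p i j => by
    simp [weightGraph]
  refine (Set.ncard_le_ncard_of_injOn (t := {s(Sum.inl 1, Sum.inr ⟨p, by omega⟩),
    s(Sum.inl 0, Sum.inr ⟨p + 1, hp⟩)}) (Sym2.map e) (fun q hq => ?_)
    (Sym2.map.injective e.injective).injOn).trans ((Set.ncard_insert_le _ _).trans
      (by rw [Set.ncard_singleton]))
  refine edgeSet_symmDiff_moverWeight (s := s) hp ?_
  induction q using Sym2.ind with
  | h i j =>
    rw [Set.mem_symmDiff] at hq ⊢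
    simpa only [SimpleGraph.mem_edgeSet, hadj, Sym2.map_mk] using hq

/-- The position of the mover joined to both hubs in round `k`: it goes up and down. -/
def moverPos (D k : ℕ) : ℕ := if Even (k / D) then k % D else D - 1 - k % D

lemma moverPos_lt (hD : 0 < D) (k : ℕ) : moverPos D k < D := by
  have := Nat.mod_lt k hD
  unfold moverPos
  split_ifs <;> omega

lemma moverPos_succ (hD : 0 < D) (k : ℕ) :
    moverPos D (k + 1) = moverPos D k ∨ moverPos D (k + 1) = moverPos D k + 1 ∨
      moverPos D k = moverPos D (k + 1) + 1 := by
  have hi := Nat.mod_lt k hD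
  have hk : D * (k / D) + k % D = k := Nat.div_add_mod k D
  unfold moverPos
  by_cases hlast : k % D + 1 < D
  · obtain ⟨h1, h2⟩ : (k + 1) / D = k / D ∧ (k + 1) % D = k % D + 1 :=
      (Nat.div_mod_unique hD).2 ⟨by omega, hlast⟩
    rw [h1, h2]
    split_ifs <;> omega
  -- At a turning point the sweep repeats its extreme position, so the graph does not change.
  · obtain ⟨h1, h2⟩ : (k + 1) / D = k / D + 1 ∧ (k + 1) % D = 0 :=
      (Nat.div_mod_unique hD).2 ⟨by rw [mul_add]; omega, hD⟩
    simp only [h1, h2, Nat.even_add_one]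
    split_ifs <;> omega

lemma moverPos_mul_add (j : ℕ) {i : ℕ} (hi : i < D) :
    moverPos D (j * D + i) = if Even j then i else D - 1 - i := by
  obtain ⟨h1, h2⟩ : (j * D + i) / D = j ∧ (j * D + i) % D = i :=
    (Nat.div_mod_unique (by omega)).2 ⟨by rw [mul_comm, add_comm], hi⟩
  rw [moverPos, h1, h2]

/-- The nodes which may have been reached by round `i` of period `j`. -/
def moverReached (D j i : ℕ) : Fin 5 ⊕ Fin D → Prop
  | .inl a => if Even j then a ≠ 1 else a = 1
  | .inr t => if Even j then (t : ℕ) < i else D - 1 - i < t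

/-- In an even period the bridge at round i is mover i, not yet reached; it receives information
then, but is a leaf at hub 0 in the following round. Odd periods are the mirror image, with hub 1 as
the only reached node besides movers. -/
lemma isBarrier_moverWeight {M : ℕ} (e : Fin M ≃ Fin 5 ⊕ Fin D) :
    IsBarrier (fun k => weightGraph fun i j => moverWeight D s (moverPos D k) (e i) (e j)) D
      (e.symm (.inl 0)) (e.symm (.inl 1)) fun j i => {m | moverReached D j i (e m)} where
  source j i _ := by by_cases hj : Even j <;> simp [hj, moverReached]
  target j i _ := by by_cases hj : Even j <;> simp [hj, moverReached]
  mono j i hi m hm := by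
    simp only [Set.mem_ofPred_eq] at hm ⊢
    generalize e m = u at *
    rcases u with a | t
    · exact hm
    · by_cases hj : Even j <;> simp only [moverReached, hj, if_true, if_false] at hm ⊢ <;> omega
  adj j i hi m hm m' hadj := by
    have hadj : (weightGraph (moverWeight D s (if Even j then i else D - 1 - i))).Adj
        (e m) (e m') := by
      rw [moverPos_mul_add j (by omega)] at hadj
      simpa [weightGraph] using hadj
    simp only [Set.mem_ofPred_eq] at hm ⊢
    generalize e m = u at *
    generalize e m' = v at *
    rcases u with a | t <;> rcases v with b | u
    · have := moverWeight_adj_inl_inl hadj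
      by_cases hj : Even j
      · simpa [moverReached, hj] using this.2
      · simp [moverReached, hj, this.1] at hm
    · rw [moverWeight_adj_inl_inr] at hadj
      by_cases hj : Even j <;> simp only [moverReached, hj, if_true, if_false] at hm hadj ⊢
      · obtain ⟨-, h⟩ := hadj.resolve_right fun h => hm h.1
        omega
      · subst hm
        obtain ⟨-, h⟩ := hadj.resolve_left fun h => by simp at h
        omega
    · rw [SimpleGraph.adj_comm, moverWeight_adj_inl_inr] at hadj
      by_cases hj : Even j <;> simp only [moverReached, hj, if_true, if_false] at hm hadj ⊢
      · obtain ⟨h, -⟩ := hadj.resolve_right fun h => by omega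
        simp [h]
      · exact (hadj.resolve_left fun h => by omega).1
    · exact absurd hadj not_moverWeight_adj_inr_inr

lemma isSlowNetwork_moverWeight {M : ℕ} (e : Fin M ≃ Fin 5 ⊕ Fin D) (hD : 0 < D)
    (hs : 5 * D ≤ 1 / 8 + 2 * s) :
    IsSlowNetwork (fun k => weightGraph fun i j => moverWeight D s (moverPos D k) (e i) (e j))
      (fun k => weightLaplacian fun i j => moverWeight D s (moverPos D k) (e i) (e j))
      (1 + 16 * s) := by
  have hD1 : (1 : ℝ) ≤ D := by exact_mod_cast hD
  have hs0 : 0 ≤ s := by linarith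
  have hχ : (1 + 16 * s) * (1 / 8) = 1 / 8 + 2 * s := by ring
  refine isSlowNetwork_of_weights e (w := fun k => moverWeight D s (moverPos D k)) (a := 1 / 8)
    (fun k => moverWeight_nonneg hs0) (by norm_num)
    (fun k x => moverWeight_quadratic_ge hD (moverPos_lt hD k) hs0)
    (fun k x => hχ ▸ moverWeight_quadratic_le hD hs x)
    (fun k => ⟨_, fun h => ?_, moverWeight_eigen_small⟩)
    (fun k => ⟨_, fun h => ?_, hχ ▸ moverWeight_eigen_large⟩) fun k => ?_
  · simpa using congrFun h (.inl 2)
  · simpa using congrFun h (.inl 2)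
  · have h1 := moverPos_lt hD k
    have h2 := moverPos_lt hD (k + 1)
    rcases moverPos_succ hD k with h | h | h
    · simp [h]
    · simp only [h]
      exact ncard_symmDiff_moverWeight_le e (by omega)
    · simp only [h]
      rw [symmDiff_comm]
      exact ncard_symmDiff_moverWeight_le e (by omega)

end

lemma exists_slowNetwork_isBarrier {χ : ℝ} (hχ : 1 ≤ χ) :
    ∃ (M : ℕ) (G : ℕ → SimpleGraph (Fin M)) (W : ℕ → Matrix (Fin M) (Fin M) ℝ) (D : ℕ)
      (l r : Fin M) (A : ℕ → ℕ → Set (Fin M)),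
      IsSlowNetwork G W χ ∧ l ≠ r ∧ 0 < D ∧ χ ≤ 80 * D ∧ IsBarrier G D l r A := by
  -- For s = (χ - 1)/16 the hypothesis of `isSlowNetwork_moverWeight` reads D ≤ χ/40, which allows D
  -- ≥ 1 only from χ = 40 on; rounding down then costs at most a factor 2, hence 80.
  by_cases h : χ < 40
  · obtain ⟨G, W, A, hW, hA⟩ := exists_slowNetwork_triangle hχ
    exact ⟨3, G, W, 1, 0, 1, A, hW, by decide, one_pos, by norm_num; linarith, hA⟩
  · push Not at h
    have h0 : 0 ≤ χ / 40 := by positivity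
    have hD : 0 < ⌊χ / 40⌋₊ := Nat.floor_pos.2 (by linarith)
    have h1 := Nat.floor_le h0
    have h2 := Nat.lt_floor_add_one (χ / 40)
    have hD1 : (1 : ℝ) ≤ ⌊χ / 40⌋₊ := by exact_mod_cast hD
    set D := ⌊χ / 40⌋₊
    let e : Fin (5 + D) ≃ Fin 5 ⊕ Fin D := finSumFinEquiv.symm
    have hnet := isSlowNetwork_moverWeight (s := (χ - 1) / 16) e hD (by linarith)
    rw [show 1 + 16 * ((χ - 1) / 16) = χ by ring] at hnet
    exact ⟨_, _, _, D, _, _, _, hnet, by simp, hD, by linarith, isBarrier_moverWeight e⟩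

/-! ### Decay rate and the quantitative lower bound. -/

lemma exists_decay_rate {μ β : ℝ} (hμ : 0 < μ) (hβ : 0 < β) :
    ∃ ρ : ℝ, 0 < ρ ∧ ρ ≤ 1 ∧ β * ρ ^ 2 + μ * ρ = β ∧ -Real.log ρ ≤ μ / β := by
  set t := √(μ ^ 2 + 4 * β ^ 2)
  have ht : t ^ 2 = μ ^ 2 + 4 * β ^ 2 := Real.sq_sqrt (by positivity)
  have ht1 : μ < t := Real.lt_sqrt_of_sq_lt (by nlinarith [sq_pos_of_pos hβ])
  have ht0 : 0 ≤ t := Real.sqrt_nonneg _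
  set ρ := (t - μ) / (2 * β) with hρ
  have hρ0 : 0 < ρ := div_pos (by linarith) (by positivity)
  have heq : β * ρ ^ 2 + μ * ρ = β := by
    rw [hρ]
    field_simp
    nlinarith
  have hρ1 : ρ ≤ 1 := by
    by_contra! h
    nlinarith [mul_pos hβ (mul_pos (sub_pos.2 h) (by linarith : 0 < ρ + 1)), mul_pos hμ hρ0]
  refine ⟨ρ, hρ0, hρ1, heq, ?_⟩
  rw [← Real.log_inv]
  -- The equation divided by βρ gives 1/ρ - 1 = ρ - 1 + μ/β ≤ μ/β.
  refine (Real.log_le_sub_one_of_pos (by positivity)).trans ?_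
  rw [le_div_iff₀ hβ]
  have : ρ⁻¹ * β = β * ρ + μ := by
    rw [inv_mul_eq_iff_eq_mul₀ hρ0.ne']
    linarith
  nlinarith

/-- Reaching accuracy `ε` takes a level proportional to `log (R ^ 2 / ε)`. -/
lemma level_ge_of_error_le {n k : ℕ} {μ β ρ s R ε : ℝ} (hβ : 0 < β) (hμ : 0 < μ)
    (hρ : 0 < ρ) (hρ1 : ρ ≤ 1) (hlog : -Real.log ρ ≤ μ / β) (hR : 0 < R) (hε : 0 < ε)
    (hs : ‖s • geomVec n (ρ ^ 2)‖ = R) (hε4 : 4 * ε ≤ R ^ 2)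
    (hn : β / (4 * μ) * Real.log (R ^ 2 / ε) ≤ n) {y : EucSpace n} (hy : y ∈ levelY n k)
    (herr : ‖y - s • geomVec n (ρ ^ 2)‖ ^ 2 ≤ ε) :
    β / (4 * μ) * Real.log (R ^ 2 / ε) ≤ k + 1 := by
  by_cases hk : k + 1 ≤ n
  · have h1 := norm_sub_geomVec_ge s hρ.le hρ1 hk hy
    rw [hs] at h1
    have h2 : R ^ 2 / ε * ρ ^ (2 * (k + 1)) ≤ 2 := by
      rw [div_mul_eq_mul_div, div_le_iff₀ hε]
      linarith
    have h3 := Real.log_le_log (by positivity) h2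
    rw [Real.log_mul (by positivity) (by positivity), Real.log_pow] at h3
    -- The stray log 2 is absorbed by half of the logarithm; this is the use of 4ε ≤ R².
    have h4 : 2 * Real.log 2 ≤ Real.log (R ^ 2 / ε) := by
      rw [show 2 * Real.log 2 = Real.log 4 by
        rw [show (4 : ℝ) = 2 ^ 2 by norm_num, Real.log_pow]; norm_num]
      exact Real.log_le_log (by norm_num) (by rwa [le_div_iff₀ hε])
    have h5 : ((2 * (k + 1) : ℕ) : ℝ) * -Real.log ρ ≤ (2 * (k + 1) : ℕ) * (μ / β) := by gcongr
    have h6 : Real.log (R ^ 2 / ε) ≤ 4 * (k + 1) * (μ / β) := by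
      push_cast at h3 h5
      linarith
    calc β / (4 * μ) * Real.log (R ^ 2 / ε) ≤ β / (4 * μ) * (4 * (k + 1) * (μ / β)) := by gcongr
      _ = k + 1 := by field_simp
  · refine hn.trans ?_
    push Not at hk
    exact_mod_cast hk.le

section
variable {M : ℕ} {G : ℕ → SimpleGraph (Fin M)} {D : ℕ} {l r : Fin M} {A : ℕ → ℕ → Set (Fin M)}

lemma lower_bound_of_isBarrier {κ₀ L μ χ R ε₀ : ℝ} (hκ₀ : 1 < κ₀) (hμ : 0 < μ) (hL : κ₀ * μ ≤ L)
    (hχ : 1 ≤ χ) (hlr : l ≠ r) (hD : 0 < D) (hDχ : χ ≤ 80 * D) (hA : IsBarrier G D l r A)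
    (hR : 0 < R) (hε₀ : 0 < ε₀) :
    ∃ N : ℕ, ∀ n : ℕ, N ≤ n →
      ∃ (f : Fin M → EucSpace n → EucSpace n → ℝ) (xs ys : EucSpace n),
        IsSaddleProblem f L μ ∧
        IsSaddlePointOn Set.univ Set.univ (globalObjective f) xs ys ∧
        xs ≠ 0 ∧ ys ≠ 0 ∧ ‖ys‖ = R ∧ ‖xs‖ ≤ 2 * ‖ys‖ ∧
        ∀ ε : ℝ, ε₀ ≤ ε → ε ≤ min (1 / 4) (Real.exp (-(48 / (κ₀ - 1)))) * ‖ys‖ ^ 2 →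
          ∀ (T K : ℕ) (x y : EucSpace n), BBPOutput f G T K x y →
            ‖x - xs‖ ^ 2 + ‖y - ys‖ ^ 2 ≤ ε →
            (1 - κ₀⁻¹) / 1920 * χ * (L / μ) * Real.log (‖ys‖ ^ 2 / ε) ≤ K ∧
            (1 - κ₀⁻¹) / 1920 * (L / μ) * Real.log (‖ys‖ ^ 2 / ε) ≤ T := by
  -- Chosen so that the global Lipschitz constant μ + 3β equals L.
  set β := (L - μ) / 3 with hβdef
  have hκ0 : 0 < κ₀ := by linarith
  have hβκ : (κ₀ - 1) * μ ≤ 3 * β := by rw [hβdef]; linarith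
  have hβ : 0 < β := by nlinarith
  have hβL : (1 - κ₀⁻¹) * L ≤ 3 * β := by
    have : μ ≤ κ₀⁻¹ * L := by rwa [le_inv_mul_iff₀ hκ0]
    rw [hβdef]
    linarith
  have hLβ : μ + 3 * β = L := by rw [hβdef]; ring
  obtain ⟨ρ, hρ, hρ1, hρeq, hρlog⟩ := exists_decay_rate hμ hβ
  -- The chain must outlast the level needed for the smallest admissible accuracy `ε₀`; the extra 1
  -- keeps the dimension positive.
  refine ⟨⌈β / (4 * μ) * Real.log (R ^ 2 / ε₀)⌉₊ + 1, fun n hn => ?_⟩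
  obtain ⟨m, rfl⟩ : ∃ m, n = m + 1 := ⟨n - 1, by omega⟩
  have hv : ‖geomVec (m + 1) (ρ ^ 2)‖ ≠ 0 := norm_ne_zero_iff.2 (geomVec_ne_zero m _)
  set s := R / ‖geomVec (m + 1) (ρ ^ 2)‖ with hsdef
  set ys := s • geomVec (m + 1) (ρ ^ 2) with hys
  have hnorm : ‖ys‖ = R := by
    rw [hys, norm_smul, hsdef, norm_div, norm_norm, Real.norm_of_nonneg hR.le,
      div_mul_cancel₀ _ hv]
  have hys0 : ys ≠ 0 := norm_ne_zero_iff.1 (hnorm ▸ hR.ne')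
  have hM : (M : ℝ) ≠ 0 := by
    have : 0 < M := l.pos
    positivity
  set P : Fin M → ℝ := fun i => if i = r then M else 0 with hP
  set Q : Fin M → ℝ := fun i => if i = l then M else 0 with hQ
  have hPsum : ∑ i, P i = M := by simp [hP]
  have hQsum : ∑ i, Q i = M := by simp [hQ]
  have hP0 : ∀ i, 0 ≤ P i := fun i => by simp only [hP]; split_ifs <;> positivity
  have hQ0 : ∀ i, 0 ≤ Q i := fun i => by simp only [hQ]; split_ifs <;> positivity
  set f : Fin M → EucSpace (m + 1) → EucSpace (m + 1) → ℝ := fun i =>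
    chainFun (leftShift m) (EuclideanSpace.single 0 1) (EuclideanSpace.single (Fin.last m) 1)
      μ β ρ (s * (μ + β * ρ)) (P i) (Q i) with hf
  have hpres : ∀ i k, i ≠ l ∨ Odd k → i ≠ r ∨ Even k → PreservesLevel (f i) k := by
    intro i k h1 h2
    refine preservesLevel_chainFun _ _ _ _ (h2.imp_left fun h => ?_) (h1.imp_left fun h => ?_)
    · simp [hP, h]
    · simp [hQ, h]
  refine ⟨f, ρ • ys, ys, ?_, ?_, smul_ne_zero hρ.ne' hys0, hys0, hnorm, ?_, ?_⟩
  · rw [← hLβ]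
    exact isSaddleProblem_chainFun _ (rightShift m) _ _ _ _ _ _ P Q inner_leftShift
      norm_leftShift_le norm_rightShift_le (by simp) hμ.le hβ.le hρ.le hρ1 hM hPsum hQsum hP0 hQ0
  · rw [hf, globalObjective_chainFun _ _ _ _ _ _ _ P Q hM hPsum hQsum]
    exact isSaddlePointOn_geomVec m s hμ.le hβ.le hρ.le hρeq
  · rw [norm_smul, Real.norm_of_nonneg hρ.le]
    nlinarith [norm_nonneg ys]
  · rw [hnorm]
    rintro ε hε₁ hε₂ T K x y ⟨S, hS, -, hy⟩ herr
    have hε : 0 < ε := hε₀.trans_le hε₁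
    have hε4 : 4 * ε ≤ R ^ 2 := by
      have := mul_le_mul_of_nonneg_right
        (min_le_left (1 / 4) (Real.exp (-(48 / (κ₀ - 1))))) (sq_nonneg R)
      linarith
    have hεlog : 48 / (κ₀ - 1) ≤ Real.log (R ^ 2 / ε) := by
      rw [Real.le_log_iff_exp_le (by positivity), le_div_iff₀ hε]
      have := mul_le_mul_of_nonneg_right
        (min_le_right (1 / 4) (Real.exp (-(48 / (κ₀ - 1))))) (sq_nonneg R)
      calc _ ≤ Real.exp (48 / (κ₀ - 1)) * (Real.exp (-(48 / (κ₀ - 1))) * R ^ 2) := by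
            gcongr
            linarith
        _ = R ^ 2 := by rw [← mul_assoc, ← Real.exp_add, add_neg_cancel, Real.exp_zero, one_mul]
    set ℓ := Real.log (R ^ 2 / ε) with hℓ
    have hκ1 : 0 < κ₀ - 1 := by linarith
    have hℓ0 : 0 ≤ ℓ := le_trans (by positivity) hεlog
    set B := β / (4 * μ) * ℓ with hB
    -- This makes the additive losses harmless: K/D ≥ B - 2 ≥ B/2, and likewise T ≥ B - 1.
    have hB4 : 4 ≤ B := by
      have h1 : (κ₀ - 1) / 12 ≤ β / (4 * μ) := by
        rw [div_le_div_iff₀ (by norm_num) (by positivity)]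
        linarith
      calc (4 : ℝ) = (κ₀ - 1) / 12 * (48 / (κ₀ - 1)) := by field_simp; norm_num
        _ ≤ B := by rw [hB]; gcongr
    have hBL : (1 - κ₀⁻¹) / 12 * (L / μ) * ℓ ≤ B := by
      rw [hB]
      gcongr
      rw [div_mul_div_comm, div_le_div_iff₀ (by positivity) (by positivity)]
      nlinarith
    have hn' : B ≤ ((m + 1 : ℕ) : ℝ) := by
      have h1 : B ≤ β / (4 * μ) * Real.log (R ^ 2 / ε₀) := by
        rw [hB, hℓ]
        gcongr
      have h2 : ⌈β / (4 * μ) * Real.log (R ^ 2 / ε₀)⌉₊ ≤ m + 1 := by omega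
      exact h1.trans ((Nat.le_ceil _).trans (by exact_mod_cast h2))
    have herr' : ‖y - ys‖ ^ 2 ≤ ε := by linarith [sq_nonneg ‖x - ρ • ys‖]
    have hlevel : ∀ k, S.LevelLE (fun _ => k) → B ≤ k + 1 := fun k hk =>
      level_ge_of_error_le hβ hμ hρ hρ1 hρlog hR hε hnorm hε4 hn' (hk.span_y hy) herr'
    constructor
    · have h1 : B ≤ ((K / D + 1 : ℕ) : ℝ) + 1 := by
        refine hlevel _ ((hS.levelLE_barrierLevel hD hA hpres).mono fun i => ?_)
        unfold barrierLevel
        split_ifs <;> omega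
      have h2 : ((K / D : ℕ) : ℝ) * D ≤ K := by exact_mod_cast Nat.div_mul_le_self K D
      push_cast at h1 h2
      have h3 : B / 2 * D ≤ K := by
        refine le_trans ?_ h2
        gcongr
        linarith
      calc (1 - κ₀⁻¹) / 1920 * χ * (L / μ) * ℓ
          = χ / 160 * ((1 - κ₀⁻¹) / 12 * (L / μ) * ℓ) := by ring
        _ ≤ χ / 160 * B := by gcongr
        _ ≤ (80 * D) / 160 * B := by gcongr
        _ = B / 2 * D := by ring
        _ ≤ K := h3
    · have h1 : B ≤ T + 1 := by
        refine hlevel _ (hS.levelLE_iterations fun i k => ?_)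
        by_cases hi : i = l
        · have hr : i ≠ r := fun h => hlr (hi ▸ h)
          rcases Nat.even_or_odd k with hk | hk
          · exact .inr (hpres _ _ (.inr hk.add_one) (.inl hr))
          · exact .inl (hpres _ _ (.inr hk) (.inl hr))
        · rcases Nat.even_or_odd k with hk | hk
          · exact .inl (hpres _ _ (.inl hi) (.inr hk))
          · exact .inr (hpres _ _ (.inl hi) (.inr hk.add_one))
      calc (1 - κ₀⁻¹) / 1920 * (L / μ) * ℓ
          = 1 / 160 * ((1 - κ₀⁻¹) / 12 * (L / μ) * ℓ) := by ring
        _ ≤ 1 / 160 * B := by gcongr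
        _ ≤ T := by linarith

end

end

theorem mainTheorem2 (κ₀ : ℝ) (hκ₀ : 1 < κ₀) :
    ∃ c : ℝ, 0 < c ∧ ∃ δ : ℝ, 0 < δ ∧
      ∀ L μ χ : ℝ, 0 < μ → κ₀ * μ ≤ L → 1 ≤ χ →
        ∃ (M : ℕ) (G : ℕ → SimpleGraph (Fin M)) (W : ℕ → Matrix (Fin M) (Fin M) ℝ),
          IsSlowNetwork G W χ ∧
          ∀ R ε₀ : ℝ, 0 < R → 0 < ε₀ →
            ∃ N : ℕ, ∀ n : ℕ, N ≤ n →
              ∃ (f : Fin M → EucSpace n → EucSpace n → ℝ) (xs ys : EucSpace n),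
                IsSaddleProblem f L μ ∧
                IsSaddlePointOn Set.univ Set.univ (globalObjective f) xs ys ∧
                xs ≠ 0 ∧ ys ≠ 0 ∧ ‖ys‖ = R ∧ ‖xs‖ ≤ 2 * ‖ys‖ ∧
                ∀ ε : ℝ, ε₀ ≤ ε → ε ≤ δ * ‖ys‖ ^ 2 →
                  ∀ (T K : ℕ) (x y : EucSpace n), BBPOutput f G T K x y →
                    ‖x - xs‖ ^ 2 + ‖y - ys‖ ^ 2 ≤ ε →
                    c * χ * (L / μ) * Real.log (‖ys‖ ^ 2 / ε) ≤ K ∧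
                    c * (L / μ) * Real.log (‖ys‖ ^ 2 / ε) ≤ T := by
  -- 1920 = 12 · 160: the 12 comes from β/(4μ) with β = (L - μ)/3, and 160 from halving the level
  -- and from χ ≤ 80D. In δ, 1/4 absorbs log 2 and the exponential forces the required level to be
  -- at least 4.
  refine ⟨(1 - κ₀⁻¹) / 1920, div_pos (sub_pos.2 (inv_lt_one_of_one_lt₀ hκ₀)) (by norm_num),
    min (1 / 4) (Real.exp (-(48 / (κ₀ - 1)))), lt_min (by norm_num) (Real.exp_pos _), ?_⟩
  intro L μ χ hμ hL hχ
  obtain ⟨M, G, W, D, l, r, A, hW, hlr, hD, hDχ, hA⟩ := exists_slowNetwork_isBarrier hχ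
  exact ⟨M, G, W, hW, fun R ε₀ hR hε₀ =>
    lower_bound_of_isBarrier hκ₀ hμ hL hχ hlr hD hDχ hA hR hε₀⟩
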